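/- Let $A$ be a (not necessarily unital) complex $C^*$-algebra. Subalgebras of $C^*$-algebras are norm-closed $*$-subalgebras and ideals are closed and two-sided. A minimal projection in a $C^*$-algebra $B$ is a nonzero projection $p\in B$ ($p=p^*=p^2$) with $pBp=\mathbb{C}p$, and $\mathcal{I}^{At}(B)$ denotes the $C^*$-subalgebra of $B$ generated by all minimal projections of $B$ (it is $\{0\}$ if there are none). A sequence $(\mathcal{I}_\alpha)_{\alpha\le\theta}$ of ideals indexed by ordinals is increasing if $\mathcal{I}_\alpha\subsetneq\mathcal{I}_\beta$ for $\alpha<\beta\le\theta$, and continuous if $\mathcal{I}_\lambda=\overline{\bigcup_{\alpha<\lambda}\mathcal{I}_\alpha}$ for every nonzero limit ordinal $\lambda\le\theta$. Then the following six conditions are equivalent: 1. Every nonzero $*$-homomorphic image of $A$ (that is, every nonzero $C^*$-algebra $B$ admitting a surjective $*$-homomorphism $A\to B$) has a minimal projection. 2. There are an ordinal $ht(A)$ and a continuous increasing sequence of ideals $(\mathcal{I}_\alpha)_{\alpha\le ht(A)}$ of $A$ with $\mathcal{I}_0=\{0\}$, $\mathcal{I}_{ht(A)}=A$ and $$\mathcal{I}^{At}(A/\mathcal{I}_\alpha)=\{[a]_{\mathcal{I}_\alpha}: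 a\in\mathcal{I}_{\alpha+1}\}\qquad\text{for every }\alpha<ht(A).$$ 3. There are an ordinal $m(A)$ and a continuous increasing sequence of ideals $(\mathcal{J}_\alpha)_{\alpha\le m(A)}$ of $A$ with $\mathcal{J}_0=\{0\}$, $\mathcal{J}_{m(A)}=A$ such that for every $\alpha<m(A)$ the quotient $\mathcal{J}_{\alpha+1}/\mathcal{J}_\alpha$ is an elementary $C^*$-algebra, i.e. $*$-isomorphic to the algebra of all compact operators on some complex Hilbert space. 4. Every nonzero $C^*$-subalgebra of $A$ has a minimal projection. 5. $A$ does not contain a copy of $C_0((0,1])=\{f\in C((0,1],\mathbb{C}):\lim_{x\to0}f(x)=0\}$; that is, there is no injective $*$-homomorphism $C_0((0,1])\to A$. 6. Every self-adjoint element of $A$ has countable spectrum (computed in the unitization of $A$ if $A$ is not unital). -/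

import Mathlib

open scoped ZeroAtInfty

universe u

/-- A closed two-sided ideal of a (not necessarily unital) `C^*`-algebra. -/
structure ClosedIdeal (A : Type u) [NonUnitalCStarAlgebra A] extends Submodule ℂ A where
  mul_mem_left' : ∀ (a : A) {x : A}, x ∈ carrier → a * x ∈ carrier
  mul_mem_right' : ∀ (a : A) {x : A}, x ∈ carrier → x * a ∈ carrier
  isClosed' : IsClosed carrier

namespace ClosedIdeal

section Basic

variable {A : Type u} [NonUnitalCStarAlgebra A]

theorem toSubmodule_injective :
    Function.Injective (toSubmodule : ClosedIdeal A → Submodule ℂ A) := by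
  rintro ⟨s, _, _, _⟩ ⟨t, _, _, _⟩ h
  cases h
  rfl

instance : SetLike (ClosedIdeal A) A where
  coe I := I.carrier
  coe_injective _ _ h := toSubmodule_injective (SetLike.coe_injective h)

/-- Closed ideals are ordered by inclusion. -/
instance : PartialOrder (ClosedIdeal A) := PartialOrder.ofSetLike (ClosedIdeal A) A

theorem mem_toSubmodule {I : ClosedIdeal A} {x : A} : x ∈ I.toSubmodule ↔ x ∈ I := Iff.rfl

theorem mul_mem_left (I : ClosedIdeal A) (a : A) {x : A} (hx : x ∈ I) : a * x ∈ I :=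
  I.mul_mem_left' a hx

theorem mul_mem_right (I : ClosedIdeal A) (a : A) {x : A} (hx : x ∈ I) : x * a ∈ I :=
  I.mul_mem_right' a hx

theorem isClosed (I : ClosedIdeal A) : IsClosed (I : Set A) := I.isClosed'

instance (I : ClosedIdeal A) : IsClosed (I.toSubmodule : Set A) := I.isClosed'

/-- For self-adjoint `b` in a closed ideal `I` and `δ > 0` there is a self-adjoint `u ∈ I` with
`‖1 - u‖ ≤ 1` in the unitization, such that `‖y - y * u‖ ^ 2 ≤ δ` whenever `star y * y = b`. -/
theorem exists_approx (I : ClosedIdeal A) {b : A} (hb : b ∈ I) (hsa : IsSelfAdjoint b)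
    {δ : ℝ} (hδ : 0 < δ) :
    ∃ u ∈ I, IsSelfAdjoint u ∧ ‖(1 - (u : Unitization ℂ A))‖ ≤ 1 ∧
      ∀ y : A, star y * y = b → ‖y - y * u‖ * ‖y - y * u‖ ≤ δ := by
  let f : ℝ → ℝ := fun x => x ^ 2 / (x ^ 2 + δ ^ 2)
  let g : ℝ → ℝ := fun x => 1 - f x
  have hpos : ∀ x : ℝ, 0 < x ^ 2 + δ ^ 2 := fun x => by positivity
  have hf : Continuous f := by
    refine Continuous.div (by fun_prop) (by fun_prop) fun x => (hpos x).ne'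
  have hg : Continuous g := by fun_prop
  have hgx : ∀ x, g x = δ ^ 2 / (x ^ 2 + δ ^ 2) := fun x => by
    have := (hpos x).ne'
    simp only [g, f]
    field_simp
    ring
  have hf0 : f 0 = 0 := by simp [f]
  let S : NonUnitalStarSubalgebra ℝ A :=
    { carrier := {x | x ∈ I ∧ star x ∈ I}
      add_mem' := fun {x y} hx hy => ⟨I.add_mem hx.1 hy.1, by
        rw [star_add]; exact I.add_mem hx.2 hy.2⟩
      zero_mem' := ⟨I.zero_mem, by rw [star_zero]; exact I.zero_mem⟩
      mul_mem' := fun {x y} hx hy => ⟨I.mul_mem_left _ hy.1, by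
        rw [star_mul]; exact I.mul_mem_left _ hx.2⟩
      smul_mem' := fun c x hx => ⟨by
        have := I.smul_mem (c : ℂ) hx.1
        simpa using! this, by
        have := I.smul_mem (c : ℂ) hx.2
        rw [star_smul]
        simpa using! this⟩
      star_mem' := fun {x} hx => ⟨hx.2, by rw [star_star]; exact hx.1⟩ }
  have hS : IsClosed (S : Set A) :=
    I.isClosed.inter (I.isClosed.preimage continuous_star)
  have hbS : b ∈ S := ⟨hb, by rw [hsa.star_eq]; exact hb⟩
  have : IsClosed (S : Set A) := hS
  have hu : cfcₙ f b ∈ S := cfcₙ_mem (𝕜' := ℝ) (s := S) f hbS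
  have husa : IsSelfAdjoint (cfcₙ f b) := IsSelfAdjoint.cfcₙ
  have hwsa : IsSelfAdjoint (b : Unitization ℂ A) := Unitization.isSelfAdjoint_inr (R := ℂ) |>.2 hsa
  have hv : 1 - ((cfcₙ f b : A) : Unitization ℂ A) = cfc g (b : Unitization ℂ A) := by
    rw [Unitization.real_cfcₙ_eq_cfc_inr b f hf0,
      cfc_sub (fun _ => 1) f (b : Unitization ℂ A) (by fun_prop) hf.continuousOn, cfc_const_one ℝ _]
  refine ⟨cfcₙ f b, hu.1, husa, ?_, fun y hy => ?_⟩
  · rw [hv]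
    refine norm_cfc_le zero_le_one fun x _ => ?_
    rw [hgx, Real.norm_of_nonneg (by positivity), div_le_one (hpos x)]
    nlinarith [sq_nonneg x]
  · have key : ((y - y * cfcₙ f b : A) : Unitization ℂ A)
        = (y : Unitization ℂ A) * cfc g (b : Unitization ℂ A) := by
      rw [← hv]
      simp [mul_sub]
    have hgsa : star (cfc g (b : Unitization ℂ A)) = cfc g (b : Unitization ℂ A) :=
      (IsSelfAdjoint.cfc (f := g)).star_eq
    have h2 : star ((y : Unitization ℂ A) * cfc g (b : Unitization ℂ A)) *
        ((y : Unitization ℂ A) * cfc g (b : Unitization ℂ A))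
        = cfc (fun x => g x * x * g x) (b : Unitization ℂ A) := by
      rw [star_mul, hgsa, mul_assoc, ← mul_assoc (star _), ← Unitization.inr_star,
        ← Unitization.inr_mul, hy, ← mul_assoc,
        cfc_mul (fun x => g x * x) g (b : Unitization ℂ A) (by fun_prop) (by fun_prop),
        cfc_mul g (fun x => x) (b : Unitization ℂ A) (by fun_prop) (by fun_prop), cfc_id' ℝ _]
    rw [← Unitization.norm_inr (𝕜 := ℂ), key, ← CStarRing.norm_star_mul_self, h2]
    refine norm_cfc_le hδ.le fun x _ => ?_
    have hp := hpos x
    rw [hgx, Real.norm_eq_abs, abs_mul, abs_mul,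
      abs_of_nonneg (show (0 : ℝ) ≤ δ ^ 2 / (x ^ 2 + δ ^ 2) by positivity)]
    have h3 : δ ^ 2 / (x ^ 2 + δ ^ 2) ≤ 1 := by
      rw [div_le_one hp]; nlinarith [sq_nonneg x]
    have h4 : δ ^ 2 / (x ^ 2 + δ ^ 2) * |x| ≤ δ := by
      rw [div_mul_eq_mul_div, div_le_iff₀ hp]
      nlinarith [sq_nonneg (|x| - δ), sq_abs x, abs_nonneg x]
    calc _ ≤ δ * 1 := by gcongr
      _ = δ := mul_one δ

theorem star_mem (I : ClosedIdeal A) {a : A} (ha : a ∈ I) : star a ∈ I := by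
  rw [← SetLike.mem_coe, ← I.isClosed.closure_eq, Metric.mem_closure_iff]
  intro ε hε
  obtain ⟨u, huI, -, -, hu⟩ := I.exists_approx (I.mul_mem_right (star a) ha)
    (IsSelfAdjoint.mul_star_self a) (show (0 : ℝ) < (ε / 2) * (ε / 2) by positivity)
  refine ⟨star a * u, I.mul_mem_left _ huI, ?_⟩
  have h := hu (star a) (by rw [star_star])
  rw [dist_eq_norm]
  have := abs_le_of_sq_le_sq' (by simpa [sq] using h) (by positivity : (0:ℝ) ≤ ε / 2)
  linarith [this.2]

end Basic

section Quotient

variable {A : Type u} [NonUnitalCStarAlgebra A]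

/-- The quotient `A / I`, as a vector space, with the quotient norm. -/
def Quotient (I : ClosedIdeal A) : Type u := A ⧸ I.toSubmodule

namespace Quotient

variable (I : ClosedIdeal A)

noncomputable instance : NormedAddCommGroup I.Quotient :=
  inferInstanceAs (NormedAddCommGroup (A ⧸ I.toSubmodule))

noncomputable instance : NormedSpace ℂ I.Quotient :=
  inferInstanceAs (NormedSpace ℂ (A ⧸ I.toSubmodule))

instance : CompleteSpace I.Quotient :=
  inferInstanceAs (CompleteSpace (A ⧸ I.toSubmodule))

/-- The class `[a]` of `a` in `A / I`. -/
def mk (a : A) : I.Quotient := Submodule.Quotient.mk a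

theorem mk_surjective : Function.Surjective (mk I) := Submodule.Quotient.mk_surjective _

theorem mk_eq_mk {a b : A} : mk I a = mk I b ↔ a - b ∈ I :=
  Submodule.Quotient.eq I.toSubmodule

theorem mk_add (a b : A) : mk I (a + b) = mk I a + mk I b := rfl

theorem mk_smul (c : ℂ) (a : A) : mk I (c • a) = c • mk I a := rfl

theorem mk_zero : mk I 0 = 0 := rfl

theorem norm_mk_le (a : A) : ‖mk I a‖ ≤ ‖a‖ := Submodule.Quotient.norm_mk_le I.toSubmodule a

theorem exists_norm_lt (x : I.Quotient) {ε : ℝ} (hε : 0 < ε) :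
    ∃ a : A, mk I a = x ∧ ‖a‖ < ‖x‖ + ε :=
  Submodule.Quotient.norm_mk_lt (S := I.toSubmodule) x hε

instance : Mul I.Quotient where
  mul := Quotient.map₂ (· * ·) fun a a' ha b b' hb => by
    replace ha := (Submodule.quotientRel_def I.toSubmodule).1 ha
    replace hb := (Submodule.quotientRel_def I.toSubmodule).1 hb
    refine (Submodule.quotientRel_def I.toSubmodule).2 ?_
    have : a * b - a' * b' = a * (b - b') + (a - a') * b' := by noncomm_ring
    simp only [this]
    exact I.toSubmodule.add_mem (I.mul_mem_left' _ hb) (I.mul_mem_right' _ ha)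

theorem mk_mul (a b : A) : mk I (a * b) = mk I a * mk I b := rfl

instance : Star I.Quotient where
  star := Quotient.map star fun a a' ha => by
    replace ha := (Submodule.quotientRel_def I.toSubmodule).1 ha
    refine (Submodule.quotientRel_def I.toSubmodule).2 ?_
    rw [← star_sub]
    exact I.star_mem ha

theorem mk_star (a : A) : mk I (star a) = star (mk I a) := rfl

noncomputable instance : NonUnitalNormedRing I.Quotient where
  __ := (inferInstance : NormedAddCommGroup I.Quotient)
  left_distrib x y z := by
    obtain ⟨a, rfl⟩ := mk_surjective I x
    obtain ⟨b, rfl⟩ := mk_surjective I y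
    obtain ⟨c, rfl⟩ := mk_surjective I z
    exact congrArg (mk I) (mul_add a b c)
  right_distrib x y z := by
    obtain ⟨a, rfl⟩ := mk_surjective I x
    obtain ⟨b, rfl⟩ := mk_surjective I y
    obtain ⟨c, rfl⟩ := mk_surjective I z
    exact congrArg (mk I) (add_mul a b c)
  zero_mul x := by
    obtain ⟨a, rfl⟩ := mk_surjective I x
    exact congrArg (mk I) (zero_mul a)
  mul_zero x := by
    obtain ⟨a, rfl⟩ := mk_surjective I x
    exact congrArg (mk I) (mul_zero a)
  mul_assoc x y z := by
    obtain ⟨a, rfl⟩ := mk_surjective I x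
    obtain ⟨b, rfl⟩ := mk_surjective I y
    obtain ⟨c, rfl⟩ := mk_surjective I z
    exact congrArg (mk I) (mul_assoc a b c)
  norm_mul_le x y := by
    have hlim : Filter.Tendsto (fun ε : ℝ => (‖x‖ + ε) * (‖y‖ + ε)) (nhdsWithin 0 (Set.Ioi 0))
        (nhds (‖x‖ * ‖y‖)) := by
      have : Continuous fun ε : ℝ => (‖x‖ + ε) * (‖y‖ + ε) := by fun_prop
      simpa using (this.tendsto 0).mono_left nhdsWithin_le_nhds
    refine ge_of_tendsto hlim ?_
    filter_upwards [self_mem_nhdsWithin] with ε (hε : 0 < ε)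
    obtain ⟨a, rfl, ha⟩ := exists_norm_lt I x hε
    obtain ⟨b, rfl, hb⟩ := exists_norm_lt I y hε
    calc ‖mk I a * mk I b‖ ≤ ‖a * b‖ := norm_mk_le I (a * b)
      _ ≤ ‖a‖ * ‖b‖ := norm_mul_le a b
      _ ≤ _ := by gcongr

noncomputable instance : StarRing I.Quotient where
  star_involutive x := by
    obtain ⟨a, rfl⟩ := mk_surjective I x
    exact congrArg (mk I) (star_star a)
  star_mul x y := by
    obtain ⟨a, rfl⟩ := mk_surjective I x
    obtain ⟨b, rfl⟩ := mk_surjective I y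
    exact congrArg (mk I) (star_mul a b)
  star_add x y := by
    obtain ⟨a, rfl⟩ := mk_surjective I x
    obtain ⟨b, rfl⟩ := mk_surjective I y
    exact congrArg (mk I) (star_add a b)

instance : IsScalarTower ℂ I.Quotient I.Quotient where
  smul_assoc c x y := by
    obtain ⟨a, rfl⟩ := mk_surjective I x
    obtain ⟨b, rfl⟩ := mk_surjective I y
    exact congrArg (mk I) (smul_mul_assoc c a b)

instance : SMulCommClass ℂ I.Quotient I.Quotient where
  smul_comm c x y := by
    obtain ⟨a, rfl⟩ := mk_surjective I x
    obtain ⟨b, rfl⟩ := mk_surjective I y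
    exact congrArg (mk I) (mul_smul_comm c a b).symm

instance : StarModule ℂ I.Quotient where
  star_smul c x := by
    obtain ⟨a, rfl⟩ := mk_surjective I x
    exact congrArg (mk I) (star_smul c a)

instance : CStarRing I.Quotient where
  norm_mul_self_le x := by
    obtain ⟨a, rfl⟩ := mk_surjective I x
    refine le_of_forall_pos_le_add fun ε hε => ?_
    obtain ⟨z, hz, hzlt⟩ := exists_norm_lt I (star (mk I a) * mk I a) (half_pos hε)
    have hi : z - star a * a ∈ I := (mk_eq_mk I).1 hz
    obtain ⟨i, rfl⟩ : ∃ i, z = star a * a + i := ⟨z - star a * a, by abel⟩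
    rw [add_sub_cancel_left] at hi
    obtain ⟨u, huI, husa, hu1, hu⟩ := I.exists_approx (I.mul_mem_left (star i) hi)
      (IsSelfAdjoint.star_mul_self i) (show (0 : ℝ) < (ε / 2) * (ε / 2) by positivity)
    have hiu : ‖i - i * u‖ ≤ ε / 2 :=
      (abs_le_of_sq_le_sq' (by simpa [sq] using hu i rfl) (by positivity)).2
    have hmk : mk I a = mk I (a - a * u) := by
      rw [mk_eq_mk, sub_sub_cancel]
      exact I.mul_mem_left _ huI
    have hle : ‖mk I a‖ ≤ ‖a - a * u‖ := by
      rw [hmk]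
      exact norm_mk_le I _
    set v : Unitization ℂ A := 1 - (u : Unitization ℂ A) with hvdef
    have hv : star v = v := by
      rw [hvdef, star_sub, star_one, ← Unitization.inr_star, husa.star_eq]
    have e1 : ((a - a * u : A) : Unitization ℂ A) = (a : Unitization ℂ A) * v := by
      simp [hvdef, mul_sub]
    have e2 : ((i - i * u : A) : Unitization ℂ A) = (i : Unitization ℂ A) * v := by
      simp [hvdef, mul_sub]
    have e3 : star ((a : Unitization ℂ A) * v) * ((a : Unitization ℂ A) * v)
        = v * ((star a * a + i : A) : Unitization ℂ A) * v - v * ((i : Unitization ℂ A) * v) := by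
      rw [star_mul, hv]
      simp only [Unitization.inr_add, Unitization.inr_mul, Unitization.inr_star]
      noncomm_ring
    calc ‖mk I a‖ * ‖mk I a‖ ≤ ‖a - a * u‖ * ‖a - a * u‖ := by gcongr
      _ = ‖v * ((star a * a + i : A) : Unitization ℂ A) * v - v * ((i : Unitization ℂ A) * v)‖ := by
        rw [← Unitization.norm_inr (𝕜 := ℂ), e1, ← CStarRing.norm_star_mul_self, e3]
      _ ≤ ‖v‖ * ‖((star a * a + i : A) : Unitization ℂ A)‖ * ‖v‖
          + ‖v‖ * ‖(i : Unitization ℂ A) * v‖ := by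
        refine (norm_sub_le _ _).trans (add_le_add ?_ (norm_mul_le _ _))
        exact (norm_mul_le _ _).trans (by gcongr; exact norm_mul_le _ _)
      _ ≤ 1 * ‖star a * a + i‖ * 1 + 1 * (ε / 2) := by
        rw [← e2, Unitization.norm_inr, Unitization.norm_inr]
        gcongr
      _ ≤ ‖star (mk I a) * mk I a‖ + ε := by linarith

/-- The quotient of a `C^*`-algebra by a closed two-sided ideal is a `C^*`-algebra. -/
noncomputable instance : NonUnitalCStarAlgebra I.Quotient where

/-- The quotient map `a ↦ [a]` as a `*`-homomorphism. -/
def mkHom : A →⋆ₙₐ[ℂ] I.Quotient where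
  toFun := mk I
  map_smul' _ _ := rfl
  map_zero' := rfl
  map_add' _ _ := rfl
  map_mul' _ _ := rfl
  map_star' _ := rfl

end Quotient

/-- A closed ideal, viewed as a `C^*`-subalgebra. -/
def toStarSubalgebra (I : ClosedIdeal A) : NonUnitalStarSubalgebra ℂ A where
  __ := I.toSubmodule
  mul_mem' {x _} _ hy := I.mul_mem_left' x hy
  star_mem' hx := I.star_mem hx

/-- `J / I = {[a] : a ∈ J}` as a `*`-subalgebra of `A / I`
(to be used for `I ≤ J`, when it is the quotient of `J` by `I`). -/
noncomputable def subquotient (J I : ClosedIdeal A) : NonUnitalStarSubalgebra ℂ I.Quotient :=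
  J.toStarSubalgebra.map (Quotient.mkHom I)

end Quotient

end ClosedIdeal

/-- A minimal projection: a nonzero projection `p` with `p B p = ℂ p`. -/
def IsMinimalProjection {B : Type u} [NonUnitalRing B] [StarRing B] [Module ℂ B] (p : B) : Prop :=
  p ≠ 0 ∧ IsStarProjection p ∧
    Set.range (fun b : B => p * b * p) = Set.range (fun c : ℂ => c • p)

/-- The `C^*`-subalgebra generated by the minimal projections. -/
noncomputable def atomicIdeal (B : Type u) [NonUnitalCStarAlgebra B] :
    NonUnitalStarSubalgebra ℂ B :=
  (NonUnitalStarAlgebra.adjoin ℂ {p : B | IsMinimalProjection p}).topologicalClosure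

/-- The compact operators on a Hilbert space, as a closed ideal of the bounded operators. -/
def compactIdeal (H : Type u) [NormedAddCommGroup H] [InnerProductSpace ℂ H] [CompleteSpace H] :
    ClosedIdeal (H →L[ℂ] H) where
  __ := compactOperator (RingHom.id ℂ) H H
  mul_mem_left' a _ hx := IsCompactOperator.clm_comp hx a
  mul_mem_right' a _ hx := IsCompactOperator.comp_clm hx a
  isClosed' := by
    have h := (compactOperator (RingHom.id ℂ) H H).isClosed_topologicalClosure
    rwa [compactOperator_topologicalClosure] at h

/-- An elementary `C^*`-algebra: one that is `*`-isomorphic to the algebra of all compact operators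
on some complex Hilbert space. -/
def IsElementary (B : Type u) [NonUnitalRing B] [StarRing B] [Module ℂ B] : Prop :=
  ∃ (H : Type u) (_ : NormedAddCommGroup H) (_ : InnerProductSpace ℂ H) (_ : CompleteSpace H),
    Nonempty (B ≃⋆ₐ[ℂ] (compactIdeal H).toStarSubalgebra)

/-- `(I α)_{α ≤ o}` is a continuous increasing sequence of closed ideals from `{0}` to `A`.
The values of `I` above `o` play no role. -/
structure IsIdealSeries {A : Type u} [NonUnitalCStarAlgebra A] (o : Ordinal.{u})
    (I : Ordinal.{u} → ClosedIdeal A) : Prop where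
  strictMonoOn : StrictMonoOn I (Set.Iic o)
  zero : (I 0 : Set A) = {0}
  top : (I o : Set A) = Set.univ
  limit : ∀ l ≤ o, Order.IsSuccLimit l → (I l : Set A) = closure (⋃ α < l, (I α : Set A))

universe v

/-!
Both ideal series are built by transfinite recursion: as long as an ideal `I` is proper, `A ⧸ I` has
a minimal projection, and one passes to the preimage of the closed ideal generated by all minimal
projections, respectively by a single one. The latter quotient is elementary: a minimal projection
`p` of `B` turns the left ideal `B p` into a Hilbert space with `⟪x, y⟫ p = x⋆ y`, and `B` acts on
it with the ideal generated by `p` mapping isomorphically onto the compact operators.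

Spectra are controlled along a series by the fact that a real function vanishing on the spectrum of
`[a] ∈ A ⧸ I` sends `a` into `I`. If an uncountable amount of spectrum of `a` lay off that of `[a]`,
a continuous function could map it onto `[0, 1]`, giving an element of `I` with uncountable
spectrum.

Conversely, countable spectra provide projections by functional calculus. If none of them were
minimal, one could split projections indefinitely into orthogonal nonzero pieces, and weighting the
resulting binary tree by the digits of the Cantor set gives an element with uncountable spectrum.

The interval `(0, 1]` is connected and not compact, so `C₀((0, 1])` has no nonzero projection; on
the other hand an uncountable spectrum maps continuously onto `[0, 1]`, and an element with
spectrum `[0, 1]` generates a copy of `C₀((0, 1])`.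
-/

namespace ClosedIdeal

variable {A : Type u} {B : Type v} [NonUnitalCStarAlgebra A] [NonUnitalCStarAlgebra B]

instance : InfSet (ClosedIdeal A) where
  sInf s :=
    { carrier := ⋂ I ∈ s, I
      add_mem' hx hy := Set.mem_iInter₂.2 fun I hI =>
        I.add_mem (Set.mem_iInter₂.1 hx I hI) (Set.mem_iInter₂.1 hy I hI)
      zero_mem' := Set.mem_iInter₂.2 fun I _ => I.zero_mem
      smul_mem' c _ hx := Set.mem_iInter₂.2 fun I hI => I.smul_mem c (Set.mem_iInter₂.1 hx I hI)
      mul_mem_left' a _ hx := Set.mem_iInter₂.2 fun I hI =>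
        I.mul_mem_left a (Set.mem_iInter₂.1 hx I hI)
      mul_mem_right' a _ hx := Set.mem_iInter₂.2 fun I hI =>
        I.mul_mem_right a (Set.mem_iInter₂.1 hx I hI)
      isClosed' := isClosed_biInter fun I _ => I.isClosed }

theorem mem_sInf {s : Set (ClosedIdeal A)} {x : A} : x ∈ sInf s ↔ ∀ I ∈ s, x ∈ I :=
  Set.mem_iInter₂

instance : CompleteLattice (ClosedIdeal A) where
  __ := completeLatticeOfInf (ClosedIdeal A) fun _ =>
    ⟨fun I hI _ hx => mem_sInf.1 hx I hI, fun _ hJ _ hx => mem_sInf.2 fun _ hI => hJ hI hx⟩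
  bot :=
    { (⊥ : Submodule ℂ A) with
      mul_mem_left' := by rintro a _ rfl; exact mul_zero a
      mul_mem_right' := by rintro a _ rfl; exact zero_mul a
      isClosed' := isClosed_singleton }
  bot_le I := by rintro _ rfl; exact I.zero_mem
  top :=
    { (⊤ : Submodule ℂ A) with
      mul_mem_left' := fun _ _ _ => trivial
      mul_mem_right' := fun _ _ _ => trivial
      isClosed' := isClosed_univ }
  le_top _ _ _ := trivial

theorem mem_bot {x : A} : x ∈ (⊥ : ClosedIdeal A) ↔ x = 0 := Iff.rfl

theorem mem_top (x : A) : x ∈ (⊤ : ClosedIdeal A) := trivial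

theorem coe_bot : ((⊥ : ClosedIdeal A) : Set A) = {0} := rfl

theorem coe_top : ((⊤ : ClosedIdeal A) : Set A) = Set.univ := rfl

theorem coe_iSup_of_directed {ι : Type*} [Nonempty ι] {I : ι → ClosedIdeal A}
    (hI : Directed (· ≤ ·) I) :
    ((⨆ i, I i : ClosedIdeal A) : Set A) = closure (⋃ i, (I i : Set A)) := by
  have hmem (x : A) : x ∈ (⨆ i, (I i).toSubmodule) ↔ ∃ i, x ∈ I i :=
    Submodule.mem_iSup_of_directed _ hI
  have hcoe : ((⨆ i, (I i).toSubmodule : Submodule ℂ A) : Set A) = ⋃ i, (I i : Set A) :=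
    Submodule.coe_iSup_of_directed _ hI
  let J : ClosedIdeal A :=
    { (⨆ i, (I i).toSubmodule).topologicalClosure with
      mul_mem_left' := fun a _ hx => map_mem_closure (f := (a * ·)) (by fun_prop) hx fun y hy => by
        obtain ⟨i, hi⟩ := (hmem y).1 hy
        exact (hmem _).2 ⟨i, (I i).mul_mem_left a hi⟩
      mul_mem_right' := fun a _ hx => map_mem_closure (f := (· * a)) (by fun_prop) hx fun y hy => by
        obtain ⟨i, hi⟩ := (hmem y).1 hy
        exact (hmem _).2 ⟨i, (I i).mul_mem_right a hi⟩
      isClosed' := Submodule.isClosed_topologicalClosure _ }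
  have hJ : (J : Set A) = closure (⋃ i, (I i : Set A)) := congrArg closure hcoe
  refine subset_antisymm ?_ (closure_minimal (Set.iUnion_subset (le_iSup I)) (isClosed _))
  rw [← hJ]
  refine iSup_le (a := J) fun i => ?_
  rw [← SetLike.coe_subset_coe, hJ]
  exact (Set.subset_iUnion (fun i => (I i : Set A)) i).trans subset_closure

/-- The closed two-sided ideal generated by a set. -/
def span (s : Set A) : ClosedIdeal A := sInf {I | s ⊆ I}

theorem subset_span (s : Set A) : s ⊆ span s := fun _ hx => mem_sInf.2 fun _ hI => hI hx

theorem span_le {s : Set A} {I : ClosedIdeal A} : span s ≤ I ↔ s ⊆ I :=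
  ⟨(subset_span s).trans, fun h => sInf_le (a := I) h⟩

theorem mem_span_singleton_self (x : A) : x ∈ span {x} := subset_span _ rfl

theorem span_singleton_ne_bot {x : A} (hx : x ≠ 0) : span {x} ≠ ⊥ := fun h =>
  hx (mem_bot.1 (h ▸ mem_span_singleton_self x))

/-- The preimage of a closed ideal under a `*`-homomorphism. -/
def comap (φ : A →⋆ₙₐ[ℂ] B) (J : ClosedIdeal B) : ClosedIdeal A where
  __ := J.toSubmodule.comap (φ : A →ₗ[ℂ] B)
  mul_mem_left' a x hx := by
    change φ (a * x) ∈ J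
    exact map_mul φ a x ▸ J.mul_mem_left _ hx
  mul_mem_right' a x hx := by
    change φ (x * a) ∈ J
    exact map_mul φ x a ▸ J.mul_mem_right _ hx
  isClosed' := J.isClosed.preimage
    (AddMonoidHomClass.continuous_of_bound φ 1 fun x => by
      simpa only [one_mul] using NonUnitalStarAlgHom.norm_apply_le φ x)

theorem mem_comap {φ : A →⋆ₙₐ[ℂ] B} {J : ClosedIdeal B} {x : A} : x ∈ comap φ J ↔ φ x ∈ J :=
  Iff.rfl

/-- The kernel of a `*`-homomorphism. -/
def ker (φ : A →⋆ₙₐ[ℂ] B) : ClosedIdeal A := comap φ ⊥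

theorem mem_ker {φ : A →⋆ₙₐ[ℂ] B} {x : A} : x ∈ ker φ ↔ φ x = 0 := Iff.rfl

theorem ker_ne_top [Nontrivial B] {φ : A →⋆ₙₐ[ℂ] B} (hφ : Function.Surjective φ) :
    ker φ ≠ ⊤ := fun h => by
  obtain ⟨b, hb⟩ := exists_ne (0 : B)
  obtain ⟨a, rfl⟩ := hφ b
  exact hb (mem_ker.1 (h ▸ mem_top a))

namespace Quotient

variable (I : ClosedIdeal A)

theorem mkHom_apply (a : A) : mkHom I a = mk I a := rfl

theorem mk_eq_zero {a : A} : mk I a = 0 ↔ a ∈ I := by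
  rw [← mk_zero, mk_eq_mk, sub_zero]

theorem nontrivial_of_ne_top {I : ClosedIdeal A} (hI : I ≠ ⊤) : Nontrivial I.Quotient := by
  by_contra h
  rw [not_nontrivial_iff_subsingleton] at h
  exact hI (top_le_iff.1 fun a _ => (mk_eq_zero I).1 (Subsingleton.elim _ _))

variable {I} in
/-- A `*`-homomorphism that vanishes on `I`, factored through `A / I`. -/
def lift (φ : A →⋆ₙₐ[ℂ] B) (h : I ≤ ker φ) : I.Quotient →⋆ₙₐ[ℂ] B where
  toFun := I.toSubmodule.liftQ (φ : A →ₗ[ℂ] B) h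
  map_smul' := map_smul _
  map_zero' := map_zero _
  map_add' := map_add _
  map_mul' x y := by
    obtain ⟨a, rfl⟩ := mk_surjective I x
    obtain ⟨b, rfl⟩ := mk_surjective I y
    exact map_mul φ a b
  map_star' x := by
    obtain ⟨a, rfl⟩ := mk_surjective I x
    exact map_star φ a

end Quotient

theorem le_comap_mkHom {I : ClosedIdeal A} (K : ClosedIdeal I.Quotient) :
    I ≤ comap (Quotient.mkHom I) K := fun x hx => by
  rw [mem_comap, Quotient.mkHom_apply, (Quotient.mk_eq_zero I).2 hx]
  exact K.zero_mem

theorem lt_comap_mkHom {I : ClosedIdeal A} {K : ClosedIdeal I.Quotient} (hK : K ≠ ⊥) :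
    I < comap (Quotient.mkHom I) K := by
  refine lt_of_le_not_ge (le_comap_mkHom K) fun h => hK (le_bot_iff.1 fun x hx => ?_)
  obtain ⟨a, rfl⟩ := Quotient.mk_surjective I x
  exact (Quotient.mk_eq_zero I).2 (h hx)

theorem subquotient_comap_mkHom {I : ClosedIdeal A} (K : ClosedIdeal I.Quotient) :
    (comap (Quotient.mkHom I) K).subquotient I = K.toStarSubalgebra :=
  SetLike.coe_injective (Set.image_preimage_eq _ (Quotient.mk_surjective I))

theorem coe_subquotient (J I : ClosedIdeal A) :
    (J.subquotient I : Set I.Quotient) = {x | ∃ a ∈ J, Quotient.mk I a = x} := rfl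

end ClosedIdeal

section Series

open ClosedIdeal

variable {A : Type u} [NonUnitalCStarAlgebra A]

theorem exists_isIdealSeries_of_lt (D : ClosedIdeal A → ClosedIdeal A) (hD : ∀ I ≠ ⊤, I < D I) :
    ∃ (o : Ordinal.{u}) (I : Ordinal.{u} → ClosedIdeal A), IsIdealSeries o I ∧
      ∀ α < o, I α ≠ ⊤ ∧ I (α + 1) = D (I α) := by
  classical
  let E : ClosedIdeal A → ClosedIdeal A := fun I => if I = ⊤ then ⊤ else D I
  have hE (I : ClosedIdeal A) (hI : I ≠ ⊤) : E I = D I := if_neg hI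
  have hE_lt (I : ClosedIdeal A) (hI : I ≠ ⊤) : I < E I := (hE I hI).symm ▸ hD I hI
  have hE_le (I : ClosedIdeal A) : I ≤ E I := by
    by_cases hI : I = ⊤
    · exact hI ▸ (if_pos rfl : E ⊤ = ⊤).ge
    · exact (hE_lt I hI).le
  let I : Ordinal.{u} → ClosedIdeal A := fun α => transfiniteIterate E α ⊥
  have hmono : Monotone I := monotone_transfiniteIterate E ⊥ hE_le
  have hzero : I 0 = ⊥ := transfiniteIterate_bot (J := Ordinal.{u}) E ⊥
  have hsucc (α : Ordinal.{u}) : I (α + 1) = E (I α) := by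
    rw [← Order.succ_eq_add_one]
    exact transfiniteIterate_succ E ⊥ α (not_isMax α)
  have hlimit (l : Ordinal.{u}) (hl : Order.IsSuccLimit l) : I l = ⨆ x : Set.Iio l, I x.1 :=
    transfiniteIterate_limit E ⊥ l hl
  have hex : ∃ α, I α = ⊤ := by
    have : Small.{u} (ClosedIdeal A) := small_of_injective SetLike.coe_injective
    exact top_mem_range_transfiniteIterate E ⊥ hE_lt (if_pos rfl) (not_injective_of_ordinal _)
  obtain ⟨o, ho, hmin⟩ := WellFounded.has_min (wellFounded_lt (α := Ordinal.{u})) {α | I α = ⊤} hex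
  have hne (α : Ordinal.{u}) (hα : α < o) : I α ≠ ⊤ := fun h => hmin α h hα
  refine ⟨o, I, ⟨fun α _ β hβ hαβ => ?_, ?_, ?_, fun l _ hl => ?_⟩,
    fun α hα => ⟨hne α hα, (hsucc α).trans (hE _ (hne α hα))⟩⟩
  · calc I α < E (I α) := hE_lt _ (hne α (hαβ.trans_le hβ))
      _ = I (α + 1) := (hsucc α).symm
      _ ≤ I β := hmono (Order.add_one_le_of_lt hαβ)
  · rw [hzero, coe_bot]
  · exact ho ▸ coe_top
  · have : Nonempty (Set.Iio l) := ⟨⟨0, hl.bot_lt⟩⟩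
    have hdir : Directed (· ≤ ·) fun x : Set.Iio l => I x :=
      (hmono.comp (Subtype.mono_coe _)).directed_le
    rw [hlimit l hl, coe_iSup_of_directed hdir, Set.iUnion_subtype]
    rfl

theorem exists_isIdealSeries {P : ∀ I : ClosedIdeal A, ClosedIdeal I.Quotient → Prop}
    (hP : ∀ I ≠ ⊤, ∃ K ≠ ⊥, P I K) :
    ∃ (o : Ordinal.{u}) (I : Ordinal.{u} → ClosedIdeal A), IsIdealSeries o I ∧
      ∀ α < o, ∃ K, P (I α) K ∧ (I (α + 1)).subquotient (I α) = K.toStarSubalgebra := by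
  choose! K hK_ne hK using hP
  obtain ⟨o, I, hI, hI_succ⟩ := exists_isIdealSeries_of_lt
    (fun I => comap (Quotient.mkHom I) (K I)) fun I hI => lt_comap_mkHom (hK_ne I hI)
  refine ⟨o, I, hI, fun α hα => ⟨K (I α), hK _ (hI_succ α hα).1, ?_⟩⟩
  rw [(hI_succ α hα).2, subquotient_comap_mkHom]

variable {o : Ordinal.{u}} {I : Ordinal.{u} → ClosedIdeal A}

theorem IsIdealSeries.exists_succ_not_le (hI : IsIdealSeries o I) {K : ClosedIdeal A}
    (hK : K ≠ ⊤) : ∃ β < o, I β ≤ K ∧ ¬ I (β + 1) ≤ K := by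
  have htop : ¬ I o ≤ K := fun h => hK <| top_le_iff.1 <| by
    rwa [← SetLike.coe_subset_coe, hI.top, ← coe_top] at h
  obtain ⟨α, ⟨hαo, hα⟩, hmin⟩ := WellFounded.has_min (wellFounded_lt (α := Ordinal.{u}))
    {α | α ≤ o ∧ ¬ I α ≤ K} ⟨o, le_rfl, htop⟩
  have hlt (β : Ordinal.{u}) (hβ : β < α) : I β ≤ K := by
    by_contra h
    exact hmin β ⟨hβ.le.trans hαo, h⟩ hβ
  rcases Ordinal.zero_or_succ_or_isSuccLimit α with rfl | ⟨β, rfl⟩ | hlim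
  · refine absurd (SetLike.coe_subset_coe.1 ?_) hα
    rw [hI.zero, ← coe_bot, SetLike.coe_subset_coe]
    exact bot_le
  · exact ⟨β, (Order.lt_succ β).trans_le hαo, hlt β (Order.lt_succ β), hα⟩
  · refine absurd (SetLike.coe_subset_coe.1 ?_) hα
    rw [hI.limit α hαo hlim]
    exact closure_minimal (Set.iUnion₂_subset hlt) K.isClosed

end Series

section MinimalProjection

theorem isMinimalProjection_iff {B : Type u} [NonUnitalRing B] [StarRing B] [Module ℂ B]
    [IsScalarTower ℂ B B] [SMulCommClass ℂ B B] {p : B} :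
    IsMinimalProjection p ↔
      p ≠ 0 ∧ IsStarProjection p ∧ ∀ b : B, ∃ c : ℂ, p * b * p = c • p := by
  refine and_congr_right fun _ => and_congr_right fun hp => ?_
  refine ⟨fun h b => ?_, fun h => Set.Subset.antisymm ?_ ?_⟩
  · obtain ⟨c, hc⟩ : p * b * p ∈ Set.range (fun c : ℂ => c • p) := h ▸ Set.mem_range_self b
    exact ⟨c, hc.symm⟩
  · rintro _ ⟨b, rfl⟩
    exact (h b).imp fun _ => Eq.symm
  · rintro _ ⟨c, rfl⟩
    exact ⟨c • p, by simp only [mul_smul_comm, smul_mul_assoc, hp.isIdempotentElem.eq]⟩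

theorem norm_eq_one_of_isStarProjection {B : Type*} [NonUnitalNormedRing B] [StarRing B]
    [CStarRing B] {p : B} (hp : IsStarProjection p) (h0 : p ≠ 0) : ‖p‖ = 1 := by
  have h := CStarRing.norm_star_mul_self (x := p)
  rw [hp.isSelfAdjoint.star_eq, hp.isIdempotentElem.eq] at h
  exact (mul_eq_left₀ (norm_ne_zero_iff.2 h0)).1 h.symm

namespace IsMinimalProjection

section NonUnitalRing

variable {B C : Type u} [NonUnitalRing B] [StarRing B] [Module ℂ B] {p : B}

theorem ne_zero (hp : IsMinimalProjection p) : p ≠ 0 := hp.1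

theorem mul_self (hp : IsMinimalProjection p) : p * p = p := hp.2.1.isIdempotentElem.eq

theorem star_eq (hp : IsMinimalProjection p) : star p = p := hp.2.1.isSelfAdjoint.star_eq

theorem mul_star_eq (hp : IsMinimalProjection p) {x : B} (hx : x * p = x) :
    p * star x = star x := by
  rw [← congrArg star hx, star_mul, hp.star_eq, ← mul_assoc, hp.mul_self]

variable [IsScalarTower ℂ B B] [SMulCommClass ℂ B B]

theorem exists_eq_smul (hp : IsMinimalProjection p) (b : B) : ∃ c : ℂ, p * b * p = c • p :=
  (isMinimalProjection_iff.1 hp).2.2 b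

theorem map [NonUnitalRing C] [StarRing C] [Module ℂ C] [IsScalarTower ℂ C C]
    [SMulCommClass ℂ C C] (hp : IsMinimalProjection p) (φ : B →⋆ₙₐ[ℂ] C)
    (hφ : Function.Surjective φ) (h0 : φ p ≠ 0) : IsMinimalProjection (φ p) := by
  refine isMinimalProjection_iff.2 ⟨h0, hp.2.1.map φ, hφ.forall.2 fun b => ?_⟩
  obtain ⟨c, hc⟩ := hp.exists_eq_smul b
  exact ⟨c, by rw [← map_mul, ← map_mul, hc, map_smul]⟩

theorem mul_star_of_star_mul_eq (hp : IsMinimalProjection p) {v : B} (hvp : v * p = v)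
    (hv : star v * v = p) : IsMinimalProjection (v * star v) := by
  have hpv : p * star v = star v := hp.mul_star_eq hvp
  refine isMinimalProjection_iff.2 ⟨fun h => hp.ne_zero ?_, ⟨?_, .mul_star_self v⟩, fun b => ?_⟩
  · calc p = star v * (v * star v) * v := by rw [← mul_assoc, hv, mul_assoc, hv, hp.mul_self]
      _ = 0 := by rw [h, mul_zero, zero_mul]
  · rw [IsIdempotentElem, mul_assoc, ← mul_assoc (star v), hv, hpv]
  · obtain ⟨c, hc⟩ := hp.exists_eq_smul (star v * b * v)
    refine ⟨c, ?_⟩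
    calc v * star v * b * (v * star v) = v * (p * star v) * b * (v * p * star v) := by
          rw [hpv, hvp]
      _ = v * (p * (star v * b * v) * p) * star v := by simp only [mul_assoc]
      _ = c • (v * star v) := by rw [hc, mul_smul_comm, hvp, smul_mul_assoc]

end NonUnitalRing

variable {B : Type u} [NonUnitalCStarAlgebra B] {p : B}

theorem star_mul_self_eq_smul (hp : IsMinimalProjection p) {x : B} (hx : x * p = x) :
    star x * x = ((‖x‖ ^ 2 : ℝ) : ℂ) • p := by
  obtain ⟨c, hc⟩ := hp.exists_eq_smul (star x * x)
  rw [← mul_assoc, hp.mul_star_eq hx, mul_assoc, hx] at hc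
  have hc_star : star c = c := by
    have h := (IsSelfAdjoint.star_mul_self x).star_eq
    rw [hc, star_smul, hp.star_eq] at h
    exact smul_left_injective ℂ hp.ne_zero h
  obtain ⟨r, rfl⟩ := Complex.conj_eq_iff_real.1 hc_star
  have hr_abs : |r| = ‖x‖ ^ 2 := by
    have h := CStarRing.norm_star_mul_self (x := x)
    rwa [hc, norm_smul, norm_eq_one_of_isStarProjection hp.2.1 hp.ne_zero, mul_one,
      Complex.norm_real, Real.norm_eq_abs, ← sq] at h
  have hr : 0 ≤ r := by
    let _ := CStarAlgebra.spectralOrder B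
    have _ := CStarAlgebra.spectralOrderedRing B
    by_contra! hneg
    have hle : r • p ≤ 0 := smul_nonpos_of_nonpos_of_nonneg hneg.le hp.2.1.nonneg
    have hge : 0 ≤ r • p := by
      rw [← Complex.coe_smul, ← hc]
      exact star_mul_self_nonneg x
    exact smul_ne_zero hneg.ne hp.ne_zero (le_antisymm hle hge)
  rw [hc, ← hr_abs, abs_of_nonneg hr]

theorem mul_star_mem_atomicIdeal (hp : IsMinimalProjection p) {x : B} (hx : x * p = x) :
    x * star x ∈ atomicIdeal B := by
  rcases eq_or_ne x 0 with rfl | hx0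
  · rw [zero_mul]
    exact zero_mem _
  have hn : ((‖x‖ : ℝ) : ℂ) ≠ 0 := Complex.ofReal_ne_zero.2 (norm_ne_zero_iff.2 hx0)
  let v : B := ((‖x‖ : ℝ) : ℂ)⁻¹ • x
  have hxv : x = ((‖x‖ : ℝ) : ℂ) • v := (smul_inv_smul₀ hn x).symm
  have hvp : v * p = v := by rw [smul_mul_assoc, hx]
  have hv : star v * v = p := by
    rw [star_smul, smul_mul_smul_comm, hp.star_mul_self_eq_smul hx, smul_smul, RCLike.star_def,
      map_inv₀, Complex.conj_ofReal]
    push_cast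
    rw [show ((‖x‖ : ℂ)⁻¹ * (‖x‖ : ℂ)⁻¹ * (‖x‖ : ℂ) ^ 2) = 1 by field_simp, one_smul]
  have hvmem : v * star v ∈ atomicIdeal B :=
    subset_closure (NonUnitalStarAlgebra.subset_adjoin ℂ _ (hp.mul_star_of_star_mul_eq hvp hv))
  rw [hxv, star_smul, smul_mul_smul_comm]
  exact SMulMemClass.smul_mem _ hvmem

end IsMinimalProjection

theorem four_smul_mul_star_eq {R : Type*} [NonUnitalRing R] [StarRing R] [Module ℂ R]
    [IsScalarTower ℂ R R] [SMulCommClass ℂ R R] [StarModule ℂ R] (x y : R) :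
    (4 : ℂ) • (x * star y) =
      (x + y) * star (x + y) - (x - y) * star (x - y) +
        Complex.I • ((x + Complex.I • y) * star (x + Complex.I • y)) -
        Complex.I • ((x - Complex.I • y) * star (x - Complex.I • y)) := by
  simp only [star_add, star_sub, star_smul, add_mul, mul_add, sub_mul, mul_sub, smul_mul_assoc,
    mul_smul_comm, smul_add, smul_sub, smul_smul, RCLike.star_def, Complex.conj_I]
  match_scalars <;> ring_nf <;> norm_num [Complex.I_sq]

variable {B : Type u} [NonUnitalCStarAlgebra B]

theorem IsMinimalProjection.mul_mem_atomicIdeal {p : B} (hp : IsMinimalProjection p) (b : B) :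
    b * p ∈ atomicIdeal B := by
  have hmem (z : ℂ) : (b * p + z • p) * star (b * p + z • p) ∈ atomicIdeal B :=
    hp.mul_star_mem_atomicIdeal (by rw [add_mul, mul_assoc, smul_mul_assoc, hp.mul_self])
  have hpolar := four_smul_mul_star_eq (b * p) p
  rw [hp.star_eq, mul_assoc, hp.mul_self] at hpolar
  have h4 : (4 : ℂ) ≠ 0 := by norm_num
  rw [← inv_smul_smul₀ h4 (b * p), hpolar]
  refine SMulMemClass.smul_mem _ (sub_mem (add_mem (sub_mem ?_ ?_)
    (SMulMemClass.smul_mem _ (hmem _))) (SMulMemClass.smul_mem _ ?_))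
  · simpa only [one_smul] using hmem 1
  · simpa only [neg_smul, one_smul, ← sub_eq_add_neg] using hmem (-1)
  · simpa only [neg_smul, ← sub_eq_add_neg] using hmem (-Complex.I)

theorem mul_mem_atomicIdeal_of_mem_adjoin {x : B}
    (hx : x ∈ NonUnitalStarAlgebra.adjoin ℂ {p : B | IsMinimalProjection p}) :
    ∀ b : B, b * x ∈ atomicIdeal B ∧ x * b ∈ atomicIdeal B := by
  have hsub : NonUnitalStarAlgebra.adjoin ℂ {p : B | IsMinimalProjection p} ≤ atomicIdeal B :=
    NonUnitalStarSubalgebra.le_topologicalClosure _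
  induction hx using NonUnitalStarAlgebra.adjoin_induction with
  | mem p hp =>
    refine fun b => ⟨hp.mul_mem_atomicIdeal b, ?_⟩
    have h := star_mem (hp.mul_mem_atomicIdeal (star b))
    rwa [star_mul, star_star, hp.star_eq] at h
  | zero => exact fun b => by simp only [mul_zero, zero_mul, zero_mem, and_self]
  | add x y _ _ hx hy =>
    exact fun b => ⟨mul_add b x y ▸ add_mem (hx b).1 (hy b).1,
      add_mul x y b ▸ add_mem (hx b).2 (hy b).2⟩
  | mul x y hx' hy' hx hy =>
    exact fun b => ⟨mul_assoc b x y ▸ mul_mem (hx b).1 (hsub hy'),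
      (mul_assoc x y b).symm ▸ mul_mem (hsub hx') (hy b).2⟩
  | smul c x _ hx =>
    exact fun b => ⟨(mul_smul_comm c b x).symm ▸ SMulMemClass.smul_mem c (hx b).1,
      (smul_mul_assoc c x b).symm ▸ SMulMemClass.smul_mem c (hx b).2⟩
  | star x _ hx =>
    intro b
    have h := hx (star b)
    exact ⟨by simpa only [star_mul, star_star] using star_mem h.2,
      by simpa only [star_mul, star_star] using star_mem h.1⟩

variable (B) in
theorem coe_atomicIdeal :
    (atomicIdeal B : Set B) = ClosedIdeal.span {p : B | IsMinimalProjection p} := by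
  have hclosed : IsClosed (atomicIdeal B : Set B) := isClosed_closure
  let J : ClosedIdeal B :=
    { (atomicIdeal B).toNonUnitalSubalgebra.toSubmodule with
      mul_mem_left' := fun b _ hx => closure_minimal
        (fun _ hy => (mul_mem_atomicIdeal_of_mem_adjoin hy b).1)
        (hclosed.preimage (f := (b * ·)) (by fun_prop)) hx
      mul_mem_right' := fun b _ hx => closure_minimal
        (fun _ hy => (mul_mem_atomicIdeal_of_mem_adjoin hy b).2)
        (hclosed.preimage (f := (· * b)) (by fun_prop)) hx
      isClosed' := hclosed }
  refine subset_antisymm ?_ (SetLike.coe_subset_coe.2 (ClosedIdeal.span_le (I := J).2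
    fun p hp => subset_closure (NonUnitalStarAlgebra.subset_adjoin ℂ _ hp)))
  refine closure_minimal ?_ (ClosedIdeal.isClosed _)
  exact NonUnitalStarAlgebra.adjoin_le
    (S := (ClosedIdeal.span {p : B | IsMinimalProjection p}).toStarSubalgebra)
    (ClosedIdeal.subset_span _)

end MinimalProjection

section CantorBendixson

open ClosedIdeal

variable {A : Type u} [NonUnitalCStarAlgebra A]

theorem exists_cantorBendixson_of_quotient
    (h : ∀ (B : Type u) [NonUnitalCStarAlgebra B] (π : A →⋆ₙₐ[ℂ] B),
      Function.Surjective π → Nontrivial B → ∃ p : B, IsMinimalProjection p) :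
    ∃ (ht : Ordinal.{u}) (I : Ordinal.{u} → ClosedIdeal A), IsIdealSeries ht I ∧
      ∀ α < ht, (atomicIdeal (I α).Quotient : Set (I α).Quotient) =
        {x | ∃ a ∈ I (α + 1), ClosedIdeal.Quotient.mk (I α) a = x} := by
  obtain ⟨o, I, hI, hsucc⟩ := exists_isIdealSeries
    (P := fun I K => K = span {p : I.Quotient | IsMinimalProjection p}) fun I hI => by
      obtain ⟨p, hp⟩ := h I.Quotient (ClosedIdeal.Quotient.mkHom I)
        (ClosedIdeal.Quotient.mk_surjective I) (ClosedIdeal.Quotient.nontrivial_of_ne_top hI)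
      exact ⟨_, fun hbot => hp.ne_zero (mem_bot.1 (hbot ▸ subset_span _ hp)), rfl⟩
  refine ⟨o, I, hI, fun α hα => ?_⟩
  obtain ⟨_, rfl, hsub⟩ := hsucc α hα
  rw [coe_atomicIdeal, ← coe_subquotient, hsub]
  rfl

theorem exists_isMinimalProjection_of_cantorBendixson {o : Ordinal.{u}}
    {I : Ordinal.{u} → ClosedIdeal A} (hI : IsIdealSeries o I)
    (hat : ∀ α < o, (atomicIdeal (I α).Quotient : Set (I α).Quotient) =
      {x | ∃ a ∈ I (α + 1), ClosedIdeal.Quotient.mk (I α) a = x})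
    {B : Type u} [NonUnitalCStarAlgebra B] [Nontrivial B] {π : A →⋆ₙₐ[ℂ] B}
    (hπ : Function.Surjective π) : ∃ p : B, IsMinimalProjection p := by
  obtain ⟨β, hβ, hker, hnot⟩ := hI.exists_succ_not_le (ker_ne_top hπ)
  let ψ : (I β).Quotient →⋆ₙₐ[ℂ] B := ClosedIdeal.Quotient.lift π hker
  have hψ : Function.Surjective ψ := fun b =>
    (hπ b).imp' (ClosedIdeal.Quotient.mk (I β)) fun _ => id
  obtain ⟨p, hp, hp0⟩ : ∃ p : (I β).Quotient, IsMinimalProjection p ∧ ψ p ≠ 0 := by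
    by_contra! hzero
    refine hnot fun a ha => ?_
    have hmem : ClosedIdeal.Quotient.mk (I β) a ∈ span {p | IsMinimalProjection p} := by
      rw [← SetLike.mem_coe, ← coe_atomicIdeal, hat β hβ]
      exact ⟨a, ha, rfl⟩
    exact span_le (I := ker ψ).2 hzero hmem
  exact ⟨ψ p, hp.map ψ hψ hp0⟩

end CantorBendixson

section CompactOperator

open InnerProductSpace CStarAlgebra

theorem isClosed_quasispectrum_real {A : Type*} [NonUnitalCStarAlgebra A] (a : A) :
    IsClosed (quasispectrum ℝ a) :=
  (NonUnitalContinuousFunctionalCalculus.isCompact_quasispectrum a).isClosed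

theorem quasispectrum_map_of_injective {A B : Type*} [NonUnitalCStarAlgebra A]
    [NonUnitalCStarAlgebra B] (φ : A →⋆ₙₐ[ℂ] B) (hφ : Function.Injective φ) {a : A}
    (ha : IsSelfAdjoint a) : quasispectrum ℝ (φ a) = quasispectrum ℝ a := by
  refine (NonUnitalAlgHom.quasispectrum_apply_subset' ℂ φ a).antisymm fun t ht => ?_
  let f : ℝ → ℝ := fun s => Metric.infDist s (quasispectrum ℝ (φ a))
  have hf : Continuous f := Metric.continuous_infDist_pt _
  have hf_zero : Set.EqOn f 0 (quasispectrum ℝ (φ a)) := fun s hs => Metric.infDist_zero_of_mem hs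
  have hf0 : f 0 = 0 := hf_zero (quasispectrum.zero_mem ℝ _)
  have hcfc : cfcₙ f a = cfcₙ (0 : ℝ → ℝ) a := by
    refine hφ ?_
    rw [φ.map_cfcₙ f a, cfcₙ_congr hf_zero, cfcₙ_zero, cfcₙ_zero, map_zero]
  have hft : f t = 0 := eqOn_of_cfcₙ_eq_cfcₙ hcfc ha hf.continuousOn hf0 continuousOn_const rfl ht
  exact ((isClosed_quasispectrum_real (φ a)).mem_iff_infDist_zero
    ⟨0, quasispectrum.zero_mem ℝ _⟩).2 hft

section

variable {𝕜 H : Type*} [RCLike 𝕜] [NormedAddCommGroup H] [InnerProductSpace 𝕜 H]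

theorem countable_of_orthonormal_of_isSeparable {ι : Type*} {v : ι → H} (hv : Orthonormal 𝕜 v)
    {s : Set H} (hs : TopologicalSpace.IsSeparable s) (hvs : ∀ i, v i ∈ s) : Countable ι := by
  have hdist {i j : ι} (hij : i ≠ j) : 1 ≤ dist (v i) (v j) := by
    have hinner : inner 𝕜 (v i) (v i - v j) = 1 := by
      rw [inner_sub_right, hv.2 hij, sub_zero, inner_self_eq_norm_sq_to_K, hv.1]
      norm_num
    calc (1 : ℝ) = ‖inner 𝕜 (v i) (v i - v j)‖ := by rw [hinner, norm_one]
      _ ≤ ‖v i‖ * ‖v i - v j‖ := norm_inner_le_norm _ _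
      _ = dist (v i) (v j) := by rw [hv.1, one_mul, dist_eq_norm]
  have hsep : TopologicalSpace.SeparableSpace (Set.range v) :=
    (hs.mono (Set.range_subset_iff.2 hvs)).separableSpace
  have hdisc : DiscreteTopology (Set.range v) := by
    refine DiscreteTopology.of_forall_le_dist one_pos ?_
    rintro ⟨_, i, rfl⟩ ⟨_, j, rfl⟩ hij
    exact hdist fun h => hij (by rw [h])
  have hcount : Countable (Set.range v) := TopologicalSpace.separableSpace_iff_countable.1 hsep
  exact (Equiv.ofInjective v hv.linearIndependent.injective).countable_iff.2 hcount

theorem isSeparable_range_of_isCompactOperator {T : H →L[𝕜] H} (hT : IsCompactOperator T) :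
    TopologicalSpace.IsSeparable (Set.range T) := by
  have hcover : Set.range T ⊆ ⋃ n : ℕ, closure (T '' Metric.closedBall 0 n) := by
    rintro _ ⟨x, rfl⟩
    obtain ⟨n, hn⟩ := exists_nat_ge ‖x‖
    exact Set.mem_iUnion.2 ⟨n, subset_closure ⟨x, mem_closedBall_zero_iff.2 hn, rfl⟩⟩
  refine TopologicalSpace.IsSeparable.mono ?_ hcover
  exact .iUnion fun n => (IsCompactOperator.isCompact_closure_image_closedBall
    (f := (T : H →ₗ[𝕜] H)) hT n).isSeparable

theorem countable_spectrum_of_isCompactOperator [CompleteSpace H] {T : H →L[𝕜] H}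
    (hT : IsCompactOperator T) (hsa : IsSelfAdjoint T) : (spectrum 𝕜 T).Countable := by
  have heigen (μ : ↥(spectrum 𝕜 T \ {0})) :
      ∃ v : H, ‖v‖ = 1 ∧ v ∈ Module.End.eigenspace (T : H →ₗ[𝕜] H) (μ : 𝕜) := by
    obtain ⟨v, hv⟩ := ((hT.hasEigenvalue_iff_mem_spectrum μ.2.2).2 μ.2.1).exists_hasEigenvector
    exact ⟨(‖v‖⁻¹ : 𝕜) • v, norm_smul_inv_norm hv.2, Submodule.smul_mem _ _ hv.1⟩
  choose v hv_norm hv_mem using heigen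
  have hv : Orthonormal 𝕜 v := ⟨hv_norm, fun μ ν hμν =>
    hsa.isSymmetric.orthogonalFamily_eigenspaces (Subtype.coe_injective.ne hμν)
      ⟨v μ, hv_mem μ⟩ ⟨v ν, hv_mem ν⟩⟩
  have hv_range (μ) : v μ ∈ Set.range T := by
    refine ⟨(μ : 𝕜)⁻¹ • v μ, ?_⟩
    have hTv : T (v μ) = (μ : 𝕜) • v μ := Module.End.mem_eigenspace_iff.1 (hv_mem μ)
    rw [map_smul, hTv, inv_smul_smul₀ μ.2.2]
  have hcount : (spectrum 𝕜 T \ {0}).Countable := Set.countable_coe_iff.1 <|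
    countable_of_orthonormal_of_isSeparable hv (isSeparable_range_of_isCompactOperator hT) hv_range
  exact (hcount.insert 0).mono (Set.subset_insert_sdiff_singleton 0 _)

theorem isCompactOperator_rankOne (x y : H) : IsCompactOperator (rankOne 𝕜 x y) := by
  rw [rankOne_def']
  exact (isCompactOperator_of_locallyCompactSpace_dom (innerSL 𝕜 y)).clm_comp
    (ContinuousLinearMap.toSpanSingleton 𝕜 x)

theorem exists_finiteDimensional_norm_sub_starProjection_mul_lt {T : H →L[𝕜] H}
    (hT : IsCompactOperator T) {ε : ℝ} (hε : 0 < ε) :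
    ∃ (U : Submodule 𝕜 H) (_ : FiniteDimensional 𝕜 U), ‖T - U.starProjection * T‖ < ε := by
  have hcompact : IsCompact (closure (T '' Metric.closedBall 0 1)) :=
    IsCompactOperator.isCompact_closure_image_closedBall (f := (T : H →ₗ[𝕜] H)) hT 1
  obtain ⟨t, -, ht, hcover⟩ := hcompact.finite_cover_balls (half_pos hε)
  let U := Submodule.span 𝕜 t
  have hU : FiniteDimensional 𝕜 U := .span_of_finite 𝕜 ht
  refine ⟨U, hU, (ContinuousLinearMap.opNorm_le_of_unit_norm (half_pos hε).le
    fun x hx => ?_).trans_lt (half_lt_self hε)⟩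
  obtain ⟨y, hyt, hy⟩ := Set.mem_iUnion₂.1 <|
    hcover (subset_closure ⟨x, mem_closedBall_zero_iff.2 hx.le, rfl⟩)
  calc ‖T x - U.starProjection (T x)‖ = ⨅ z : U, ‖T x - z‖ :=
      U.starProjection_minimal _
    _ ≤ ‖T x - y‖ := ciInf_le ⟨0, Set.forall_mem_range.2 fun _ => norm_nonneg _⟩
      (⟨y, Submodule.subset_span hyt⟩ : U)
    _ ≤ ε / 2 := (mem_ball_iff_norm.1 hy).le

theorem mem_closure_span_rankOne [CompleteSpace H] {T : H →L[𝕜] H} (hT : IsCompactOperator T) :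
    T ∈ closure (Submodule.span 𝕜 {S : H →L[𝕜] H | ∃ x y, S = rankOne 𝕜 x y} :
      Set (H →L[𝕜] H)) := by
  refine Metric.mem_closure_iff.2 fun ε hε => ?_
  obtain ⟨U, _, hU⟩ := exists_finiteDimensional_norm_sub_starProjection_mul_lt hT hε
  refine ⟨U.starProjection * T, ?_, (dist_eq_norm _ _).trans_lt hU⟩
  rw [(stdOrthonormalBasis 𝕜 U).starProjection_eq_sum_rankOne, Finset.sum_mul]
  exact Submodule.sum_mem _ fun i _ => Submodule.subset_span
    ⟨_, ContinuousLinearMap.adjoint T _, rankOne_comp ..⟩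

end

instance {A : Type u} [NonUnitalCStarAlgebra A] (I : ClosedIdeal A) :
    IsClosed (I.toStarSubalgebra : Set A) := I.isClosed

theorem countable_quasispectrum_real_iff {A : Type*} [NonUnitalCStarAlgebra A] {a : A}
    (ha : IsSelfAdjoint a) : (quasispectrum ℝ a).Countable ↔ (quasispectrum ℂ a).Countable := by
  refine ⟨fun h => ?_, fun h => ?_⟩
  · rw [← ha.quasispectrumRestricts.algebraMap_image]
    exact h.image _
  · rw [← quasispectrum.preimage_algebraMap ℂ]
    exact h.preimage_of_injOn Complex.ofReal_injective.injOn

theorem countable_quasispectrum_of_mem_compactIdeal {H : Type u} [NormedAddCommGroup H]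
    [InnerProductSpace ℂ H] [CompleteSpace H] {T : (compactIdeal H).toStarSubalgebra}
    (hT : IsSelfAdjoint T) : (quasispectrum ℝ T).Countable := by
  let ι := NonUnitalStarSubalgebraClass.subtype (compactIdeal H).toStarSubalgebra
  have hιT : IsSelfAdjoint (ι T) := hT.map ι
  rw [← quasispectrum_map_of_injective ι Subtype.coe_injective hT,
    countable_quasispectrum_real_iff hιT, quasispectrum_eq_spectrum_union_zero]
  exact (countable_spectrum_of_isCompactOperator T.2 hιT).union (Set.countable_singleton 0)

theorem countable_quasispectrum_of_isElementary {A : Type u} [NonUnitalCStarAlgebra A]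
    {S : NonUnitalStarSubalgebra ℂ A} (hS : IsElementary S) {x : A} (hxS : x ∈ S)
    (hx : IsSelfAdjoint x) : (quasispectrum ℝ x).Countable := by
  obtain ⟨H, _, _, _, ⟨e⟩⟩ := hS
  let y : S := ⟨x, hxS⟩
  have hy : IsSelfAdjoint y := Subtype.ext hx.star_eq
  have hx_sub : quasispectrum ℝ x ⊆ quasispectrum ℝ y :=
    NonUnitalAlgHom.quasispectrum_apply_subset' ℂ (NonUnitalStarSubalgebraClass.subtype S) y
  have hy_sub : quasispectrum ℝ (e.symm (e y)) ⊆ quasispectrum ℝ (e y) :=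
    NonUnitalAlgHom.quasispectrum_apply_subset' ℂ e.symm (e y)
  rw [e.symm_apply_apply] at hy_sub
  exact (countable_quasispectrum_of_mem_compactIdeal (hy.map e)).mono (hx_sub.trans hy_sub)

end CompactOperator

section LeftIdeal

open InnerProductSpace CStarAlgebra

variable {A : Type u} [NonUnitalCStarAlgebra A]

/-- `{x | x p = x}`, which is the left ideal `A p` when `p` is idempotent. For a minimal projection
`p` it is a Hilbert space on which `A` is represented by left multiplication. -/
def leftIdeal (p : A) : Submodule ℂ A where
  carrier := {x | x * p = x}
  add_mem' hx hy := (add_mul _ _ _).trans (congrArg₂ _ hx hy)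
  zero_mem' := zero_mul p
  smul_mem' c _ hx := (smul_mul_assoc c _ _).trans (congrArg _ hx)

theorem mem_leftIdeal {p x : A} : x ∈ leftIdeal p ↔ x * p = x := Iff.rfl

theorem mul_mem_leftIdeal {p : A} (hp : IsIdempotentElem p) (a : A) : a * p ∈ leftIdeal p := by
  rw [mem_leftIdeal, mul_assoc, hp.eq]

instance (p : A) : CompleteSpace (leftIdeal p) :=
  (isClosed_eq (by fun_prop) continuous_id : IsClosed (leftIdeal p : Set A)).completeSpace_coe

/-- Left multiplication by `a` on `A p`. -/
noncomputable def leftMul (p a : A) : leftIdeal p →L[ℂ] leftIdeal p :=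
  LinearMap.mkContinuous
    { toFun := fun x => ⟨a * x, by rw [mem_leftIdeal, mul_assoc, mem_leftIdeal.1 x.2]⟩
      map_add' := fun x y => Subtype.ext (mul_add a (x : A) y)
      map_smul' := fun c x => Subtype.ext (mul_smul_comm c a (x : A)) } ‖a‖
    fun x => norm_mul_le a (x : A)

theorem coe_leftMul (p a : A) (x : leftIdeal p) : (leftMul p a x : A) = a * x := rfl

theorem eq_zero_of_mem_span_of_mul_mul_eq_zero {s : Set A} {z : A} (hz : z ∈ ClosedIdeal.span s)
    (h : ∀ y ∈ s, ∀ b, z * b * y = 0) : z = 0 := by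
  let annihilator : ClosedIdeal A :=
    { carrier := {w | ∀ b, z * b * w = 0}
      add_mem' := fun hx hy b => by rw [mul_add, hx b, hy b, add_zero]
      zero_mem' := fun b => mul_zero _
      smul_mem' := fun c x hx b => by rw [mul_smul_comm, hx b, smul_zero]
      mul_mem_left' := fun a x hx b => by rw [← mul_assoc, mul_assoc z, hx (b * a)]
      mul_mem_right' := fun a x hx b => by rw [← mul_assoc, hx b, zero_mul]
      isClosed' := by
        rw [Set.ofPred_forall]
        exact isClosed_iInter fun b => isClosed_eq (by fun_prop) continuous_const }
  have hle : ClosedIdeal.span s ≤ annihilator := ClosedIdeal.span_le.2 h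
  have hzz : star (z * star z) * (z * star z) = 0 := by
    rw [star_mul, star_star, ← mul_assoc, mul_assoc z]
    exact hle ((ClosedIdeal.span s).star_mem hz) _
  exact (CStarRing.mul_star_self_eq_zero_iff z).1 ((CStarRing.star_mul_self_eq_zero_iff _).1 hzz)

variable (p : A) [hp : Fact (IsMinimalProjection p)]

theorem exists_star_mul_eq_smul (x y : leftIdeal p) : ∃ c : ℂ, star (x : A) * y = c • p := by
  obtain ⟨c, hc⟩ := hp.out.exists_eq_smul (star (x : A) * y)
  rw [← mul_assoc, hp.out.mul_star_eq x.2, mul_assoc, mem_leftIdeal.1 y.2] at hc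
  exact ⟨c, hc⟩

noncomputable instance : Inner ℂ (leftIdeal p) where
  inner x y := (exists_star_mul_eq_smul p x y).choose

theorem inner_smul_eq_star_mul (x y : leftIdeal p) : inner ℂ x y • p = star (x : A) * y :=
  (exists_star_mul_eq_smul p x y).choose_spec.symm

variable {p} in
theorem inner_eq_of_star_mul_eq_smul {x y : leftIdeal p} {c : ℂ} (h : star (x : A) * y = c • p) :
    inner ℂ x y = c :=
  smul_left_injective ℂ hp.out.ne_zero ((inner_smul_eq_star_mul p x y).trans h)

noncomputable instance : InnerProductSpace ℂ (leftIdeal p) where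
  norm_sq_eq_re_inner x := by
    rw [inner_eq_of_star_mul_eq_smul (hp.out.star_mul_self_eq_smul x.2)]
    rfl
  conj_inner_symm x y := by
    refine (inner_eq_of_star_mul_eq_smul ?_).symm
    rw [← star_star (y : A), ← star_mul, ← inner_smul_eq_star_mul, star_smul, hp.out.star_eq]
    rfl
  add_left x y z := by
    refine inner_eq_of_star_mul_eq_smul ?_
    rw [add_smul, inner_smul_eq_star_mul, inner_smul_eq_star_mul, ← add_mul, ← star_add]
    rfl
  smul_left x y c := by
    refine inner_eq_of_star_mul_eq_smul ?_
    rw [mul_smul, inner_smul_eq_star_mul, ← smul_mul_assoc]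
    exact congrArg (· * (y : A)) (star_smul c (x : A))

/-- The representation of `A` by left multiplication on the Hilbert space `A p`. -/
noncomputable def leftRep : A →⋆ₙₐ[ℂ] (leftIdeal p →L[ℂ] leftIdeal p) where
  toFun := leftMul p
  map_smul' c a := ContinuousLinearMap.ext fun x => Subtype.ext (smul_mul_assoc c a (x : A))
  map_zero' := ContinuousLinearMap.ext fun x => Subtype.ext (zero_mul (x : A))
  map_add' a b := ContinuousLinearMap.ext fun x => Subtype.ext (add_mul a b (x : A))
  map_mul' a b := ContinuousLinearMap.ext fun x => Subtype.ext (mul_assoc a b (x : A))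
  map_star' a := (ContinuousLinearMap.eq_adjoint_iff _ _).2 fun x y =>
    inner_eq_of_star_mul_eq_smul <| by
      rw [inner_smul_eq_star_mul, coe_leftMul, coe_leftMul, star_mul, star_star, mul_assoc]

theorem coe_leftRep (a : A) (x : leftIdeal p) : (leftRep p a x : A) = a * x := rfl

theorem leftRep_mul_star (x y : leftIdeal p) :
    leftRep p ((x : A) * star (y : A)) = rankOne ℂ x y := by
  refine ContinuousLinearMap.ext fun z => Subtype.ext ?_
  rw [coe_leftRep, mul_assoc, ← inner_smul_eq_star_mul, mul_smul_comm, mem_leftIdeal.1 x.2,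
    rankOne_apply, Submodule.coe_smul]

theorem span_singleton_le_comap_leftRep :
    ClosedIdeal.span {p} ≤ ClosedIdeal.comap (leftRep p) (compactIdeal (leftIdeal p)) := by
  refine ClosedIdeal.span_le.2 (Set.singleton_subset_iff.2 ?_)
  have hrankOne := leftRep_mul_star p ⟨p, hp.out.mul_self⟩ ⟨p, hp.out.mul_self⟩
  rw [hp.out.star_eq, hp.out.mul_self] at hrankOne
  exact ClosedIdeal.mem_comap.2 (hrankOne ▸ isCompactOperator_rankOne _ _)

variable {p} in
theorem eq_zero_of_leftRep_eq_zero {z : A} (hz : z ∈ ClosedIdeal.span {p}) (h : leftRep p z = 0) :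
    z = 0 := by
  refine eq_zero_of_mem_span_of_mul_mul_eq_zero hz (forall_eq.2 fun b => ?_)
  have hzx := coe_leftRep p z ⟨b * p, mul_mem_leftIdeal hp.out.2.1.isIdempotentElem b⟩
  rw [h] at hzx
  rw [mul_assoc]
  exact hzx.symm

theorem isElementary_span_singleton : IsElementary (ClosedIdeal.span {p}).toStarSubalgebra := by
  let I := (ClosedIdeal.span {p}).toStarSubalgebra
  let θ : I →⋆ₙₐ[ℂ] (leftIdeal p →L[ℂ] leftIdeal p) :=
    (leftRep p).comp (NonUnitalStarSubalgebraClass.subtype I)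
  have hθ : Function.Injective θ := (injective_iff_map_eq_zero θ).2 fun z hz =>
    Subtype.ext (eq_zero_of_leftRep_eq_zero z.2 hz)
  have hclosed : IsClosed (Set.range θ) :=
    (NonUnitalStarAlgHom.isometry θ hθ).isClosedEmbedding.isClosed_range
  have hrankOne : (Submodule.span ℂ {S : leftIdeal p →L[ℂ] leftIdeal p |
      ∃ x y, S = rankOne ℂ x y} : Set _) ⊆ Set.range θ := by
    refine Submodule.span_le (p := LinearMap.range
      (θ : I →ₗ[ℂ] (leftIdeal p →L[ℂ] leftIdeal p))).2 ?_
    rintro _ ⟨x, y, rfl⟩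
    refine ⟨⟨x * star (y : A), (ClosedIdeal.span {p}).mul_mem_right _ ?_⟩, leftRep_mul_star p x y⟩
    rw [← mem_leftIdeal.1 x.2]
    exact (ClosedIdeal.span {p}).mul_mem_left _ (ClosedIdeal.mem_span_singleton_self p)
  let φ : I →⋆ₙₐ[ℂ] (compactIdeal (leftIdeal p)).toStarSubalgebra :=
    NonUnitalStarAlgHom.codRestrict θ _ fun z => span_singleton_le_comap_leftRep p z.2
  have hφ : Function.Bijective φ := by
    refine ⟨fun x y h => hθ (congrArg Subtype.val h), fun T => ?_⟩
    obtain ⟨z, hz⟩ := closure_minimal hrankOne hclosed (mem_closure_span_rankOne T.2)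
    exact ⟨z, Subtype.ext hz⟩
  exact ⟨leftIdeal p, inferInstance, inferInstance, inferInstance, ⟨StarAlgEquiv.ofBijective φ hφ⟩⟩

end LeftIdeal

theorem exists_elementarySeries_of_quotient {A : Type u} [NonUnitalCStarAlgebra A]
    (h : ∀ (B : Type u) [NonUnitalCStarAlgebra B] (π : A →⋆ₙₐ[ℂ] B),
      Function.Surjective π → Nontrivial B → ∃ p : B, IsMinimalProjection p) :
    ∃ (m : Ordinal.{u}) (J : Ordinal.{u} → ClosedIdeal A), IsIdealSeries m J ∧
      ∀ α < m, IsElementary ((J (α + 1)).subquotient (J α)) := by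
  obtain ⟨m, J, hJ, hsucc⟩ := exists_isIdealSeries
    (P := fun I K => ∃ p : I.Quotient, IsMinimalProjection p ∧ K = ClosedIdeal.span {p})
    fun I hI => by
      obtain ⟨p, hp⟩ := h I.Quotient (ClosedIdeal.Quotient.mkHom I)
        (ClosedIdeal.Quotient.mk_surjective I) (ClosedIdeal.Quotient.nontrivial_of_ne_top hI)
      exact ⟨_, ClosedIdeal.span_singleton_ne_bot hp.ne_zero, p, hp, rfl⟩
  refine ⟨m, J, hJ, fun α hα => ?_⟩
  obtain ⟨_, ⟨p, hp, rfl⟩, hsub⟩ := hsucc α hα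
  have _ : Fact (IsMinimalProjection p) := ⟨hp⟩
  exact hsub ▸ isElementary_span_singleton p

section CantorSet

theorem exists_continuous_image_eq_Icc_of_not_countable_sdiff {X : Type*} [TopologicalSpace X]
    [PolishSpace X] {K Z : Set X} (hK : IsClosed K) (hZ : IsClosed Z) (h : ¬ (K \ Z).Countable) :
    ∃ f : X → ℝ, Continuous f ∧ (∀ x ∈ Z, f x = 0) ∧ f '' K = Set.Icc 0 1 := by
  have : PolishSpace ↥Zᶜ := hZ.isOpen_compl.polishSpace
  have hunc : ¬ ((↑) ⁻¹' K : Set ↥Zᶜ).Countable := fun hc => h <| by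
    simpa [Set.sdiff_eq, Set.inter_comm] using hc.image Subtype.val
  obtain ⟨g, hgK, hg, hginj⟩ :=
    (hK.preimage continuous_subtype_val).exists_nat_bool_injection_of_not_countable hunc
  obtain ⟨s, hs, hsurj⟩ := exists_nat_bool_continuous_surjective_of_compact unitInterval
  have hemb : Topology.IsClosedEmbedding (Sum.elim (Subtype.val : Z → X) (fun c => (g c : X))) :=
    hZ.isClosedEmbedding_subtypeVal.sumElim
      ((continuous_subtype_val.comp hg).isClosedEmbedding (Subtype.val_injective.comp hginj))
      (Function.Injective.sumElim Subtype.val_injective (Subtype.val_injective.comp hginj)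
        fun z c hzc => (g c).2 (hzc ▸ z.2))
  obtain ⟨F, hF⟩ := ContinuousMap.exists_extension hemb
    (⟨Sum.elim (fun _ => 0) s, by fun_prop⟩ : C(Z ⊕ (ℕ → Bool), unitInterval))
  have hFg (c : ℕ → Bool) : F (g c) = s c := DFunLike.congr_fun hF (Sum.inr c)
  refine ⟨fun x => F x, by fun_prop, fun x hx => ?_, Set.Subset.antisymm ?_ fun t ht => ?_⟩
  · exact congrArg Subtype.val (DFunLike.congr_fun hF (Sum.inl ⟨x, hx⟩))
  · rintro _ ⟨x, -, rfl⟩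
    exact (F x).2
  · obtain ⟨c, hc⟩ := hsurj ⟨t, ht⟩
    exact ⟨g c, hgK (Set.mem_range_self c), congrArg Subtype.val ((hFg c).trans hc)⟩

end CantorSet

section CountableSpectrum

open scoped CStarAlgebra

variable {A : Type u} [NonUnitalCStarAlgebra A]

theorem cfcₙ_mem_of_eqOn_zero {J : ClosedIdeal A} {a : A} (ha : IsSelfAdjoint a) {f : ℝ → ℝ}
    (hf : Continuous f) (h : ∀ x ∈ quasispectrum ℝ (ClosedIdeal.Quotient.mk J a), f x = 0) :
    cfcₙ f a ∈ J := by
  have hf0 : f 0 = 0 := h 0 (quasispectrum.zero_mem ℝ _)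
  have hmap := (ClosedIdeal.Quotient.mkHom J).map_cfcₙ f a hf.continuousOn hf0
  simp only [ClosedIdeal.Quotient.mkHom_apply] at hmap
  rw [← ClosedIdeal.Quotient.mk_eq_zero, hmap, cfcₙ_congr (g := fun _ => 0) h, cfcₙ_const_zero]

theorem countable_quasispectrum_sdiff_quotient {J : ClosedIdeal A}
    (hJ : ∀ b ∈ J, IsSelfAdjoint b → (quasispectrum ℝ b).Countable) {a : A}
    (ha : IsSelfAdjoint a) :
    (quasispectrum ℝ a \ quasispectrum ℝ (ClosedIdeal.Quotient.mk J a)).Countable := by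
  by_contra hunc
  obtain ⟨f, hf, hfJ, himage⟩ := exists_continuous_image_eq_Icc_of_not_countable_sdiff
    (isClosed_quasispectrum_real a) (isClosed_quasispectrum_real _) hunc
  have hf0 : f 0 = 0 := hfJ 0 (quasispectrum.zero_mem ℝ _)
  have hcount := hJ _ (cfcₙ_mem_of_eqOn_zero ha hf hfJ) (cfcₙ_predicate f a)
  rw [cfcₙ_map_quasispectrum f a hf.continuousOn hf0 ha, himage,
    Cardinal.Real.Icc_countable_iff] at hcount
  exact hcount.not_gt one_pos

theorem abs_le_norm_sub_of_mem_quasispectrum_quotient {J : ClosedIdeal A} {a c : A}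
    (ha : IsSelfAdjoint a) (hc : c ∈ J) {x : ℝ}
    (hx : x ∈ quasispectrum ℝ (ClosedIdeal.Quotient.mk J a)) : |x| ≤ ‖a - c‖ := by
  have hmk : ClosedIdeal.Quotient.mk J a = ClosedIdeal.Quotient.mk J (a - c) := by
    rwa [ClosedIdeal.Quotient.mk_eq_mk, sub_sub_cancel]
  calc |x| ≤ ‖ClosedIdeal.Quotient.mk J a‖ :=
        NonUnitalIsometricContinuousFunctionalCalculus.norm_quasispectrum_le _ hx
          (ha.map (ClosedIdeal.Quotient.mkHom J))
    _ ≤ ‖a - c‖ := hmk ▸ ClosedIdeal.Quotient.norm_mk_le J (a - c)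

theorem countable_quasispectrum_of_mem_closure_iUnion {ι : Type*} {J : ι → ClosedIdeal A}
    (hJ : ∀ i, ∀ b ∈ J i, IsSelfAdjoint b → (quasispectrum ℝ b).Countable) {a : A}
    (haJ : a ∈ closure (⋃ i, (J i : Set A))) (ha : IsSelfAdjoint a) :
    (quasispectrum ℝ a).Countable := by
  have happrox (n : ℕ) : ∃ i, ∃ c ∈ J i, ‖a - c‖ < 1 / (n + 1) := by
    obtain ⟨c, hc, hac⟩ := Metric.mem_closure_iff.1 haJ _ (Nat.one_div_pos_of_nat (n := n))
    obtain ⟨i, hci⟩ := Set.mem_iUnion.1 hc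
    exact ⟨i, c, hci, by rwa [← dist_eq_norm]⟩
  choose i c hc hac using happrox
  refine ((Set.countable_singleton 0).union (Set.countable_iUnion fun n =>
    countable_quasispectrum_sdiff_quotient (hJ (i n)) ha)).mono fun x hx => ?_
  by_cases hx0 : x = 0
  · exact Or.inl hx0
  obtain ⟨n, hn⟩ := exists_nat_one_div_lt (abs_pos.2 hx0)
  refine Or.inr (Set.mem_iUnion.2 ⟨n, hx, fun hmem => ?_⟩)
  exact ((abs_le_norm_sub_of_mem_quasispectrum_quotient ha (hc n) hmem).trans_lt
    ((hac n).trans hn)).false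

theorem countable_quasispectrum_of_elementarySeries {o : Ordinal.{u}}
    {J : Ordinal.{u} → ClosedIdeal A} (hJ : IsIdealSeries o J)
    (hel : ∀ α < o, IsElementary ((J (α + 1)).subquotient (J α))) {a : A}
    (ha : IsSelfAdjoint a) : (quasispectrum ℝ a).Countable := by
  suffices H : ∀ α ≤ o, ∀ b ∈ J α, IsSelfAdjoint b → (quasispectrum ℝ b).Countable from
    H o le_rfl a (hJ.top.ge (Set.mem_univ a)) ha
  intro α
  induction α using Ordinal.limitRecOn with
  | zero =>
    intro _ b hb _
    rw [Set.mem_singleton_iff.1 (hJ.zero.le hb), CFC.quasispectrum_zero_eq]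
    exact Set.countable_singleton 0
  | add_one β ih =>
    intro hβ b hb hsa
    have hβo : β < o := (Order.lt_succ β).trans_le hβ
    have hquot : (quasispectrum ℝ (ClosedIdeal.Quotient.mk (J β) b)).Countable :=
      countable_quasispectrum_of_isElementary (hel β hβo) ⟨b, hb, rfl⟩
        (hsa.map (ClosedIdeal.Quotient.mkHom (J β)))
    exact ((countable_quasispectrum_sdiff_quotient (ih hβo.le) hsa).union hquot).mono
      (Set.subset_sdiff_union _ _)
  | limit l hl ih =>
    intro hlo b hb hsa
    refine countable_quasispectrum_of_mem_closure_iUnion (J := fun β : Set.Iio l => J β)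
      (fun β => ih β β.2 (β.2.le.trans hlo)) ?_ hsa
    rw [Set.iUnion_coe_set]
    exact (hJ.limit l hlo hl).le hb

end CountableSpectrum

section ProjectionTree

open Filter Topology

theorem mem_quasispectrum_of_tendsto {𝕜 A : Type*} [NormedField 𝕜] [NonUnitalNormedRing A]
    [NormedSpace 𝕜 A] [IsScalarTower 𝕜 A A] [SMulCommClass 𝕜 A A] {a : A} {c : 𝕜} {v : ℕ → A}
    (hv : ∀ n, ‖v n‖ = 1) (h : Tendsto (fun n => a * v n - c • v n) atTop (𝓝 0)) :
    c ∈ quasispectrum 𝕜 a := by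
  intro hc hreg
  set x := -(hc.unit⁻¹ • a) with hx
  obtain ⟨y, -, hy⟩ := isQuasiregular_iff.1 hreg
  have hxv (n : ℕ) : v n + x * v n = -(hc.unit⁻¹ • (a * v n - c • v n)) := by
    have hcv : hc.unit⁻¹ • c • v n = v n := inv_smul_smul hc.unit (v n)
    rw [smul_sub, hcv, hx, neg_mul, smul_mul_assoc]
    abel
  have hinv (n : ℕ) : v n = (v n + x * v n) + y * (v n + x * v n) := by
    have hyv : x * v n + y * v n + y * (x * v n) = 0 := by
      rw [← mul_assoc, ← add_mul, ← add_mul, hy, zero_mul]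
    calc v n = v n + (x * v n + y * v n + y * (x * v n)) := by rw [hyv, add_zero]
      _ = (v n + x * v n) + y * (v n + x * v n) := by rw [mul_add]; abel
  have hlim : Tendsto v atTop (𝓝 0) := by
    have h0 : Tendsto (fun n => v n + x * v n) atTop (𝓝 0) := by
      simp only [hxv]
      simpa using (h.const_smul (hc.unit⁻¹ : 𝕜ˣ)).neg
    simpa [← hinv] using h0.add (h0.const_mul y)
  have hnorm : Tendsto (fun n => ‖v n‖) atTop (𝓝 1) := by simp only [hv, tendsto_const_nhds]
  exact one_ne_zero (tendsto_nhds_unique hnorm (by simpa using hlim.norm))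

/-- An infinite binary tree of nonzero projections: the projection `P x` at a node `x` is the
orthogonal sum of the projections at the two children `c false x` and `c true x` of `x`. Nodes may
be reached along several branches. -/
structure IsProjectionTree {X A : Type*} [NonUnitalRing A] [StarRing A] (P : X → A)
    (c : Bool → X → X) : Prop where
  isStarProjection : ∀ x, IsStarProjection (P x)
  ne_zero : ∀ x, P x ≠ 0
  add_eq : ∀ x, P (c false x) + P (c true x) = P x
  mul_eq_zero : ∀ x, P (c false x) * P (c true x) = 0

namespace IsProjectionTree

/-- The node reached from `x` after `n` steps along the branch `b`. -/
def node {X : Type*} (c : Bool → X → X) : ℕ → (ℕ → Bool) → X → X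
  | 0, _, x => x
  | n + 1, b, x => node c n (fun k => b (k + 1)) (c (b 0) x)

/-- The sum of the projections at those nodes `n + 1` steps below `x` whose last step is `true`. -/
def level {X A : Type*} [Add A] (P : X → A) (c : Bool → X → X) : ℕ → X → A
  | 0, x => P (c true x)
  | n + 1, x => level P c n (c false x) + level P c n (c true x)

section NonUnitalRing

variable {X A : Type*} [NonUnitalRing A] [StarRing A] {P : X → A} {c : Bool → X → X}

theorem mul_self (h : IsProjectionTree P c) (x : X) : P x * P x = P x :=
  (h.isStarProjection x).isIdempotentElem.eq

theorem mul_child_of_ne (h : IsProjectionTree P c) {i j : Bool} (hij : i ≠ j) (x : X) :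
    P (c i x) * P (c j x) = 0 := by
  have hft := h.mul_eq_zero x
  have htf := congrArg star hft
  rw [star_mul, (h.isStarProjection _).isSelfAdjoint.star_eq,
    (h.isStarProjection _).isSelfAdjoint.star_eq, star_zero] at htf
  cases i <;> cases j <;> first | exact absurd rfl hij | assumption

theorem mul_child (h : IsProjectionTree P c) (i : Bool) (x : X) : P x * P (c i x) = P (c i x) := by
  rw [← h.add_eq x, add_mul]
  cases i
  · rw [h.mul_self, h.mul_child_of_ne (by decide), add_zero]
  · rw [h.mul_self, h.mul_child_of_ne (by decide), zero_add]

theorem child_mul (h : IsProjectionTree P c) (i : Bool) (x : X) : P (c i x) * P x = P (c i x) := by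
  rw [← h.add_eq x, mul_add]
  cases i
  · rw [h.mul_self, h.mul_child_of_ne (by decide), add_zero]
  · rw [h.mul_self, h.mul_child_of_ne (by decide), zero_add]

theorem mul_node (h : IsProjectionTree P c) (n : ℕ) (b : ℕ → Bool) (x : X) :
    P x * P (node c n b x) = P (node c n b x) := by
  induction n generalizing b x with
  | zero => exact h.mul_self x
  | succ n ih =>
    change P x * P (node c n _ (c (b 0) x)) = P (node c n _ (c (b 0) x))
    rw [← ih, ← mul_assoc, h.mul_child]

theorem isSelfAdjoint_level (h : IsProjectionTree P c) (n : ℕ) (x : X) :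
    IsSelfAdjoint (level P c n x) := by
  induction n generalizing x with
  | zero => exact (h.isStarProjection _).isSelfAdjoint
  | succ n ih => exact (ih _).add (ih _)

theorem level_mul (h : IsProjectionTree P c) (n : ℕ) (x : X) :
    level P c n x * P x = level P c n x := by
  induction n generalizing x with
  | zero => exact h.child_mul true x
  | succ n ih =>
    have hchild (i : Bool) : level P c n (c i x) * P x = level P c n (c i x) := by
      rw [← ih, mul_assoc, h.child_mul]
    rw [level, add_mul, hchild, hchild]

theorem level_mul_node (h : IsProjectionTree P c) {k n : ℕ} (hkn : k < n) (b : ℕ → Bool) (x : X) :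
    level P c k x * P (node c n b x) = if b k then P (node c n b x) else 0 := by
  induction n generalizing b x k with
  | zero => exact absurd hkn k.not_lt_zero
  | succ n ih =>
    set p := P (node c (n + 1) b x)
    have hbp : P (c (b 0) x) * p = p := h.mul_node n _ _
    have hself : ∀ i ≠ b 0, P (c i x) * p = 0 := fun i hi => by
      rw [← hbp, ← mul_assoc, h.mul_child_of_ne hi, zero_mul]
    cases k with
    | zero =>
      change P (c true x) * p = _
      cases hb : b 0
      · exact hself true (by simp [hb])
      · simpa [hb] using hbp
    | succ k =>
      have hother : ∀ i ≠ b 0, level P c k (c i x) * p = 0 := fun i hi => by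
        rw [← h.level_mul, mul_assoc, hself i hi, mul_zero]
      have hbranch : level P c (k + 1) x * p = level P c k (c (b 0) x) * p := by
        rw [level, add_mul]
        cases hb : b 0
        · rw [hother true (by simp [hb]), add_zero]
        · rw [hother false (by simp [hb]), zero_add]
      rw [hbranch]
      exact ih (Nat.lt_of_succ_lt_succ hkn) (fun k => b (k + 1)) (c (b 0) x)

end NonUnitalRing

variable {X A : Type*} [NonUnitalCStarAlgebra A] {P : X → A} {c : Bool → X → X}

theorem norm_level_le (h : IsProjectionTree P c) (n : ℕ) (x : X) : ‖level P c n x‖ ≤ 2 ^ n := by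
  induction n generalizing x with
  | zero => exact ((h.isStarProjection _).norm_le _).trans_eq (pow_zero 2).symm
  | succ n ih =>
    calc ‖level P c (n + 1) x‖ ≤ 2 ^ n + 2 ^ n := norm_add_le_of_le (ih _) (ih _)
      _ = 2 ^ (n + 1) := by ring

/-- A weighted sum of the levels below `x`. Multiplication by it acts approximately as the scalar
`∑ n, 4⁻ⁿ (b n)` on projections far down the branch `b`. -/
noncomputable def cantorElement (P : X → A) (c : Bool → X → X) (x : X) : A :=
  ∑' n, (4⁻¹ ^ n : ℝ) • level P c n x

theorem norm_smul_level_le (h : IsProjectionTree P c) (n : ℕ) (x : X) :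
    ‖(4⁻¹ ^ n : ℝ) • level P c n x‖ ≤ (1 / 2) ^ n := by
  calc ‖(4⁻¹ ^ n : ℝ) • level P c n x‖ ≤ 4⁻¹ ^ n * 2 ^ n := by
        rw [norm_smul, norm_pow, norm_inv, Real.norm_ofNat]
        gcongr
        exact h.norm_level_le n x
    _ = (1 / 2) ^ n := by rw [← mul_pow]; norm_num

theorem summable_cantorElement (h : IsProjectionTree P c) (x : X) :
    Summable fun n => (4⁻¹ ^ n : ℝ) • level P c n x :=
  Summable.of_norm_bounded summable_geometric_two fun n => h.norm_smul_level_le n x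

theorem isSelfAdjoint_cantorElement (h : IsProjectionTree P c) (x : X) :
    IsSelfAdjoint (cantorElement P c x) := by
  refine tsum_star.trans (tsum_congr fun n => ?_)
  rw [star_smul, star_trivial, (h.isSelfAdjoint_level n x).star_eq]

theorem tendsto_cantorElement_mul_node (h : IsProjectionTree P c) (b : ℕ → Bool) (x : X) :
    Tendsto (fun n => cantorElement P c x * P (node c n b x) -
      Cardinal.cantorFunction 4⁻¹ b • P (node c n b x)) atTop (𝓝 0) := by
  set t : ℕ → ℝ := Cardinal.cantorFunctionAux 4⁻¹ b
  set p : ℕ → A := fun n => P (node c n b x)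
  set q : ℕ → A := fun k => (4⁻¹ ^ k : ℝ) • level P c k x
  have ht : HasSum t (Cardinal.cantorFunction 4⁻¹ b) :=
    (Cardinal.summable_cantor_function b (by norm_num) (by norm_num)).hasSum
  have hsum (n : ℕ) : cantorElement P c x * p n - Cardinal.cantorFunction 4⁻¹ b • p n =
      ∑' k, (q k * p n - t k • p n) :=
    (((h.summable_cantorElement x).hasSum.mul_right (p n)).sub (ht.smul_const (p n))).tsum_eq.symm
  have hbound (n k : ℕ) : ‖q k * p n - t k • p n‖ ≤ (1 / 2) ^ k + (1 / 2) ^ k := by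
    have hp : ‖p n‖ = 1 := norm_eq_one_of_isStarProjection (h.isStarProjection _) (h.ne_zero _)
    have ht_le : |t k| ≤ (1 / 2) ^ k := by
      cases hb : b k
      · simp [t, Cardinal.cantorFunctionAux_false hb]
      · rw [show t k = 4⁻¹ ^ k from Cardinal.cantorFunctionAux_true hb, abs_of_pos (by positivity)]
        gcongr
        norm_num
    refine norm_sub_le_of_le ?_ ?_
    · refine (norm_mul_le _ _).trans ?_
      rw [hp, mul_one]
      exact h.norm_smul_level_le k x
    · rwa [norm_smul, hp, mul_one]
  have hzero (k : ℕ) : ∀ᶠ n in atTop, q k * p n - t k • p n = 0 := by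
    filter_upwards [eventually_gt_atTop k] with n hkn
    rw [smul_mul_assoc, h.level_mul_node hkn]
    cases hb : b k <;> simp [t, p, hb]
  refine Tendsto.congr (fun n => (hsum n).symm) ?_
  rw [← tsum_zero (β := ℕ)]
  exact tendsto_tsum_of_dominated_convergence (summable_geometric_two.add summable_geometric_two)
    (fun k => tendsto_const_nhds.congr' ((hzero k).mono fun _ => Eq.symm))
    (Eventually.of_forall fun n k => hbound n k)

theorem not_countable_quasispectrum_cantorElement (h : IsProjectionTree P c) (x : X) :
    ¬ (quasispectrum ℝ (cantorElement P c x)).Countable := by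
  intro hcount
  have hinj : Function.Injective (Cardinal.cantorFunction 4⁻¹) :=
    Cardinal.cantorFunction_injective (by norm_num) (by norm_num)
  have hmem (b : ℕ → Bool) :
      Cardinal.cantorFunction 4⁻¹ b ∈ quasispectrum ℝ (cantorElement P c x) :=
    mem_quasispectrum_of_tendsto
      (fun n => norm_eq_one_of_isStarProjection (h.isStarProjection _) (h.ne_zero _))
      (h.tendsto_cantorElement_mul_node b x)
  have : Uncountable (ℕ → Bool) :=
    Cardinal.aleph0_lt_mk_iff.1 (by simp [Cardinal.aleph0_lt_continuum])
  have := hcount.to_subtype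
  exact not_injective_uncountable_countable _ (hinj.codRestrict hmem)

end IsProjectionTree

end ProjectionTree

section SpectralProjection

theorem exists_continuousOn_indicator_ne {K : Set ℝ} (hK : K.Countable) (h0 : (0 : ℝ) ∈ K) {x y : ℝ}
    (hxy : x ≠ y) : ∃ f : ℝ → ℝ, ContinuousOn f K ∧ f 0 = 0 ∧ (∀ z, f z = 0 ∨ f z = 1) ∧
      f x ≠ f y := by
  wlog hlt : x < y generalizing x y
  · obtain ⟨f, hf, hf0, hf01, hne⟩ := this hxy.symm (lt_of_le_of_ne (not_lt.1 hlt) hxy.symm)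
    exact ⟨f, hf, hf0, hf01, hne.symm⟩
  obtain ⟨r, hrK, hxr, hry⟩ := (hK.dense_compl ℝ).exists_between hlt
  have hr0 : r ≠ 0 := fun h => hrK (h ▸ h0)
  have hcont (s : Set ℝ) (hs : frontier s = {r}) :
      ContinuousOn (s.indicator fun _ => (1 : ℝ)) K := fun z hz =>
    (continuousOn_const.continuousAt_indicator fun hz' => by
      rw [hs, Set.mem_singleton_iff] at hz'
      exact hrK (hz' ▸ hz)).continuousWithinAt
  rcases hr0.lt_or_gt with hr | hr
  · refine ⟨(Set.Iio r).indicator fun _ => 1, hcont _ frontier_Iio,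
      Set.indicator_of_notMem (s := Set.Iio r) hr.not_gt _, Set.indicator_eq_zero_or_self _ _, ?_⟩
    simp [hxr, hry.le]
  · refine ⟨(Set.Ioi r).indicator fun _ => 1, hcont _ frontier_Ioi,
      Set.indicator_of_notMem (s := Set.Ioi r) hr.not_gt _, Set.indicator_eq_zero_or_self _ _, ?_⟩
    simp [hxr.le, hry]

variable {A : Type u} [NonUnitalCStarAlgebra A]

theorem isStarProjection_cfcₙ {a : A} {f : ℝ → ℝ} (hf : ContinuousOn f (quasispectrum ℝ a))
    (hf0 : f 0 = 0) (hf01 : ∀ z, f z = 0 ∨ f z = 1) : IsStarProjection (cfcₙ f a) := by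
  refine ⟨?_, cfcₙ_predicate f a⟩
  rw [IsIdempotentElem, ← cfcₙ_mul f f a hf hf0 hf hf0]
  refine cfcₙ_congr fun z _ => ?_
  rcases hf01 z with h | h <;> simp [h]

theorem exists_ne_zero_mem_quasispectrum {a : A} (ha : IsSelfAdjoint a) (ha0 : a ≠ 0) :
    ∃ x ∈ quasispectrum ℝ a, x ≠ 0 := by
  contrapose! ha0
  exact CFC.eq_zero_of_quasispectrum_eq_zero (R := ℝ) a ha0 ha

theorem exists_isStarProjection_of_countable_quasispectrum {a : A} (ha : IsSelfAdjoint a)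
    (ha0 : a ≠ 0) (hcount : (quasispectrum ℝ a).Countable) :
    ∃ p : A, IsStarProjection p ∧ p ≠ 0 := by
  obtain ⟨x, hx, hx0⟩ := exists_ne_zero_mem_quasispectrum ha ha0
  obtain ⟨f, hf, hf0, hf01, hne⟩ :=
    exists_continuousOn_indicator_ne hcount (quasispectrum.zero_mem ℝ a) hx0
  refine ⟨cfcₙ f a, isStarProjection_cfcₙ hf hf0 hf01, fun h => hne ?_⟩
  rw [← cfcₙ_const_zero ℝ a] at h
  rw [hf0, eqOn_of_cfcₙ_eq_cfcₙ h ha hf hf0 continuousOn_const rfl hx]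

/-- The corner `p A p` of a projection `p`, described by `p x = x = x p`. -/
def corner {p : A} (hp : IsSelfAdjoint p) : NonUnitalStarSubalgebra ℂ A where
  carrier := {x | p * x = x ∧ x * p = x}
  add_mem' hx hy := ⟨by rw [mul_add, hx.1, hy.1], by rw [add_mul, hx.2, hy.2]⟩
  zero_mem' := ⟨mul_zero p, zero_mul p⟩
  mul_mem' hx hy := ⟨by rw [← mul_assoc, hx.1], by rw [mul_assoc, hy.2]⟩
  smul_mem' _ _ hx := ⟨by rw [mul_smul_comm, hx.1], by rw [smul_mul_assoc, hx.2]⟩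
  star_mem' {x} hx :=
    ⟨by simpa only [star_mul, hp.star_eq] using congrArg star hx.2,
      by simpa only [star_mul, hp.star_eq] using congrArg star hx.1⟩

theorem mul_cfcₙ_of_mul_eq {p a : A} (hp : IsSelfAdjoint p) (ha : IsSelfAdjoint a) (hpa : p * a = a)
    (f : ℝ → ℝ) : p * cfcₙ f a = cfcₙ f a := by
  have hap : a * p = a := by simpa only [star_mul, hp.star_eq, ha.star_eq] using congrArg star hpa
  have : IsClosed (corner hp : Set A) :=
    (isClosed_eq (by fun_prop) continuous_id).inter (isClosed_eq (by fun_prop) continuous_id)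
  have hmem : a ∈ corner hp := ⟨hpa, hap⟩
  exact (cfcₙ_mem (𝕜' := ℂ) f hmem).1

theorem eq_zero_or_cfcₙ_eq_of_forall_subprojection {p a : A} (hp : IsStarProjection p)
    (hmin : ∀ q, IsStarProjection q → p * q = q → q = 0 ∨ q = p) (ha : IsSelfAdjoint a)
    (hpa : p * a = a) {f : ℝ → ℝ} (hf : ContinuousOn f (quasispectrum ℝ a)) (hf0 : f 0 = 0)
    (hf01 : ∀ z, f z = 0 ∨ f z = 1) :
    (∀ y ∈ quasispectrum ℝ a, f y = 0) ∨
      (cfcₙ f a = p ∧ ∀ y ∈ quasispectrum ℝ a, y ≠ 0 → f y = 1) := by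
  refine (hmin _ (isStarProjection_cfcₙ hf hf0 hf01)
    (mul_cfcₙ_of_mul_eq hp.isSelfAdjoint ha hpa f)).imp (fun h y hy => ?_)
    fun h => ⟨h, fun y hy hy0 => ?_⟩
  · rw [← cfcₙ_const_zero ℝ a] at h
    exact eqOn_of_cfcₙ_eq_cfcₙ h ha hf hf0 continuousOn_const rfl hy
  · have hfa : cfcₙ (fun z : ℝ => f z * z) a = cfcₙ (fun z : ℝ => z) a := by
      rw [cfcₙ_mul f (fun z => z) a hf hf0 continuousOn_id rfl, cfcₙ_id' ℝ a ha, h, hpa]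
    have hfy : f y * y = y := eqOn_of_cfcₙ_eq_cfcₙ hfa ha (hf.mul continuousOn_id)
      (mul_zero _) continuousOn_id rfl hy
    exact (mul_eq_right₀ hy0).1 hfy

theorem exists_eq_smul_of_forall_subprojection {p a : A} (hp : IsStarProjection p)
    (hmin : ∀ q, IsStarProjection q → p * q = q → q = 0 ∨ q = p) (ha : IsSelfAdjoint a)
    (hpa : p * a = a) (hcount : (quasispectrum ℝ a).Countable) : ∃ t : ℝ, a = t • p := by
  rcases eq_or_ne a 0 with rfl | ha0
  · exact ⟨0, (zero_smul ℝ p).symm⟩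
  obtain ⟨x, hx, hx0⟩ := exists_ne_zero_mem_quasispectrum ha ha0
  have hdich {f : ℝ → ℝ} := eq_zero_or_cfcₙ_eq_of_forall_subprojection (f := f) hp hmin ha hpa
  have hsep {y : ℝ} := exists_continuousOn_indicator_ne (x := x) (y := y) hcount
    (quasispectrum.zero_mem ℝ a)
  have honly (y) (hy : y ∈ quasispectrum ℝ a) (hy0 : y ≠ 0) : y = x := by
    by_contra hyx
    obtain ⟨f, hf, hf0, hf01, hne⟩ := hsep (Ne.symm hyx)
    rcases hdich hf hf0 hf01 with h | ⟨-, h⟩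
    · exact hne (by rw [h x hx, h y hy])
    · exact hne (by rw [h x hx hx0, h y hy hy0])
  obtain ⟨f, hf, hf0, hf01, hne⟩ := hsep hx0
  obtain ⟨hfp, hfx⟩ := (hdich hf hf0 hf01).resolve_left fun h => hne (by rw [h x hx, hf0])
  refine ⟨x, ?_⟩
  rw [← hfp, ← cfcₙ_const_mul x f a hf hf0]
  conv_lhs => rw [← cfcₙ_id' ℝ a ha]
  refine cfcₙ_congr fun y hy => ?_
  rcases eq_or_ne y 0 with rfl | hy0
  · simp only [hf0, mul_zero]
  · rw [hfx y hy hy0, mul_one, honly y hy hy0]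

theorem isMinimalProjection_of_forall_subprojection
    (hcount : ∀ a : A, IsSelfAdjoint a → (quasispectrum ℝ a).Countable) {p : A}
    (hp : IsStarProjection p) (hp0 : p ≠ 0)
    (hmin : ∀ q, IsStarProjection q → p * q = q → q = 0 ∨ q = p) : IsMinimalProjection p := by
  have hpp : p * p = p := hp.isIdempotentElem.eq
  have hsa {b : A} (hb : IsSelfAdjoint b) : ∃ t : ℝ, p * b * p = t • p := by
    have hpbp : IsSelfAdjoint (p * b * p) := hb.conjugate_self hp.isSelfAdjoint
    exact exists_eq_smul_of_forall_subprojection hp hmin hpbp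
      (by rw [mul_assoc, ← mul_assoc, hpp]) (hcount _ hpbp)
  refine isMinimalProjection_iff.2 ⟨hp0, hp, fun b => ?_⟩
  obtain ⟨s, hs⟩ := hsa (realPart b).2
  obtain ⟨t, ht⟩ := hsa (imaginaryPart b).2
  refine ⟨s + Complex.I * t, ?_⟩
  calc p * b * p
      = p * (realPart b : A) * p + Complex.I • (p * (imaginaryPart b : A) * p) := by
        conv_lhs => rw [← realPart_add_I_smul_imaginaryPart b]
        rw [mul_add, add_mul, mul_smul_comm, smul_mul_assoc]
    _ = (s + Complex.I * t : ℂ) • p := by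
        rw [hs, ht, add_smul, mul_smul, Complex.coe_smul, Complex.coe_smul]

theorem exists_isProjectionTree_of_forall_not_isMinimalProjection [Nontrivial A]
    (hcount : ∀ a : A, IsSelfAdjoint a → (quasispectrum ℝ a).Countable)
    (hno : ∀ p : A, ¬ IsMinimalProjection p) :
    ∃ (X : Type u) (_ : Nonempty X) (P : X → A) (c : Bool → X → X), IsProjectionTree P c := by
  let X := {p : A // IsStarProjection p ∧ p ≠ 0}
  have hX : Nonempty X := by
    obtain ⟨b, hb⟩ := exists_ne (0 : A)
    obtain ⟨p, hp, hp0⟩ := exists_isStarProjection_of_countable_quasispectrum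
      (.star_mul_self b) (mt (CStarRing.star_mul_self_eq_zero_iff b).1 hb)
      (hcount _ (.star_mul_self b))
    exact ⟨p, hp, hp0⟩
  have hsplit (p : X) : ∃ q r : X, q.1 + r.1 = p.1 ∧ q.1 * r.1 = 0 := by
    obtain ⟨p, hp, hp0⟩ := p
    obtain ⟨q, hq, hpq, hq0, hqp⟩ : ∃ q, IsStarProjection q ∧ p * q = q ∧ q ≠ 0 ∧ q ≠ p := by
      by_contra! h
      exact hno p (isMinimalProjection_of_forall_subprojection hcount hp hp0
        fun q hq hpq => or_iff_not_imp_left.2 (h q hq hpq))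
    have hqp' : q * p = q := by
      simpa only [star_mul, hp.isSelfAdjoint.star_eq, hq.isSelfAdjoint.star_eq]
        using congrArg star hpq
    refine ⟨⟨q, hq, hq0⟩, ⟨p - q, hq.sub_of_mul_eq_right hp hpq, sub_ne_zero.2 hqp.symm⟩,
      add_sub_cancel q p, ?_⟩
    rw [mul_sub, hqp', hq.isIdempotentElem.eq, sub_self]
  choose q r hadd hmul using hsplit
  exact ⟨X, hX, Subtype.val, fun i => cond i r q, fun x => x.2.1, fun x => x.2.2, hadd, hmul⟩

theorem exists_isMinimalProjection_of_countable_quasispectrum [Nontrivial A]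
    (hcount : ∀ a : A, IsSelfAdjoint a → (quasispectrum ℝ a).Countable) :
    ∃ p : A, IsMinimalProjection p := by
  by_contra! hno
  obtain ⟨X, ⟨x⟩, P, c, h⟩ := exists_isProjectionTree_of_forall_not_isMinimalProjection hcount hno
  exact h.not_countable_quasispectrum_cantorElement x (hcount _ (h.isSelfAdjoint_cantorElement x))

theorem exists_isMinimalProjection_subalgebra
    (hcount : ∀ a : A, IsSelfAdjoint a → (quasispectrum ℝ a).Countable)
    {S : NonUnitalStarSubalgebra ℂ A} (hS : IsClosed (S : Set A)) (hS0 : S ≠ ⊥) :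
    ∃ p : S, IsMinimalProjection p := by
  let _ : NonUnitalCStarAlgebra S := have _ := hS; inferInstance
  have _ : Nontrivial S := by
    obtain ⟨b, hbS, hb0⟩ : ∃ b ∈ S, b ≠ 0 := by
      by_contra! h
      exact hS0 (eq_bot_iff.2 fun b hb => NonUnitalStarAlgebra.mem_bot.2 (h b hb))
    exact nontrivial_of_ne (⟨b, hbS⟩ : S) 0 fun h => hb0 (congrArg Subtype.val h)
  refine exists_isMinimalProjection_of_countable_quasispectrum fun a ha => ?_
  rw [← quasispectrum_map_of_injective (NonUnitalStarSubalgebraClass.subtype S)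
    Subtype.val_injective ha]
  exact hcount _ (ha.map (NonUnitalStarSubalgebraClass.subtype S))

theorem exists_isMinimalProjection_of_surjective {B : Type v} [NonUnitalCStarAlgebra B]
    [Nontrivial B] (hcount : ∀ a : A, IsSelfAdjoint a → (quasispectrum ℝ a).Countable)
    {π : A →⋆ₙₐ[ℂ] B} (hπ : Function.Surjective π) : ∃ p : B, IsMinimalProjection p := by
  refine exists_isMinimalProjection_of_countable_quasispectrum fun b hb => ?_
  obtain ⟨a, rfl⟩ := hπ b
  have hre : π (realPart a : A) = π a := by
    rw [realPart_apply_coe, ← Complex.coe_smul, map_smul, map_add, map_star, hb.star_eq,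
      Complex.coe_smul, ← two_smul ℝ, inv_smul_smul₀ two_ne_zero]
  rw [← hre]
  exact (hcount _ (realPart a).2).mono
    (NonUnitalAlgHom.quasispectrum_apply_subset' ℂ π (realPart a : A))

end SpectralProjection

section ZeroAtInfty

open Filter Topology

theorem zeroAtInfty_eq_zero_of_isIdempotentElem {X R : Type*} [TopologicalSpace X]
    [PreconnectedSpace X] [NoncompactSpace X] [MonoidWithZero R] [IsLeftCancelMulZero R]
    [TopologicalSpace R] [T2Space R] [ContinuousMul R] {f : C₀(X, R)}
    (hf : IsIdempotentElem f) : f = 0 := by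
  have h01 : Set.MapsTo f Set.univ {0, 1} := fun x _ =>
    IsIdempotentElem.iff_eq_zero_or_one.1 (DFunLike.congr_fun hf x)
  obtain ⟨c, -, hc⟩ := isPreconnected_univ.eqOn_const_of_mapsTo (Set.toFinite {0, 1}).isDiscrete
    (map_continuous f).continuousOn h01 ⟨0, Or.inl rfl⟩
  have hlim : Tendsto f (cocompact X) (𝓝 c) :=
    tendsto_const_nhds.congr fun x => (hc (Set.mem_univ x)).symm
  ext x
  rw [hc (Set.mem_univ x)]
  exact tendsto_nhds_unique hlim (zero_at_infty f)

theorem nontrivial_zeroAtInftyContinuousMap (X : Type*) [TopologicalSpace X] [RegularSpace X]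
    [LocallyCompactSpace X] [Nonempty X] : Nontrivial C₀(X, ℂ) := by
  obtain ⟨x⟩ := ‹Nonempty X›
  obtain ⟨f, hf, -, hfc, -⟩ :=
    exists_continuous_one_zero_of_isCompact (isCompact_singleton (x := x)) isClosed_empty
      (Set.disjoint_empty _)
  let g : C₀(X, ℂ) :=
    { toFun := fun y => (f y : ℂ)
      continuous_toFun := by fun_prop
      zero_at_infty' := (Complex.continuous_ofReal.tendsto' 0 0 rfl).comp hfc.is_zero_at_infty }
  refine nontrivial_of_ne g 0 fun h => one_ne_zero (α := ℂ) ?_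
  have hgx : (f x : ℂ) = 0 := DFunLike.congr_fun h x
  rwa [hf rfl, Pi.one_apply, Complex.ofReal_one] at hgx

theorem noncompactSpace_Ioc {a b : ℝ} (hab : a < b) : NoncompactSpace (Set.Ioc a b) := by
  rwa [← not_compactSpace_iff, ← isCompact_iff_compactSpace, isCompact_Ioc_iff, not_le]

theorem not_exists_injective_of_forall_subalgebra {A : Type u} [NonUnitalCStarAlgebra A]
    {X : Type*} [TopologicalSpace X] [RegularSpace X] [LocallyCompactSpace X] [ConnectedSpace X]
    [NoncompactSpace X]
    (h : ∀ S : NonUnitalStarSubalgebra ℂ A, IsClosed (S : Set A) → S ≠ ⊥ →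
      ∃ p : S, IsMinimalProjection p) :
    ¬ ∃ φ : C₀(X, ℂ) →⋆ₙₐ[ℂ] A, Function.Injective φ := by
  rintro ⟨φ, hφ⟩
  have hclosed : IsClosed (NonUnitalStarAlgHom.range φ : Set A) :=
    (NonUnitalStarAlgHom.isometry φ hφ).isClosedEmbedding.isClosed_range
  have hne : NonUnitalStarAlgHom.range φ ≠ ⊥ := fun hbot => by
    have _ := nontrivial_zeroAtInftyContinuousMap X
    obtain ⟨f, hf⟩ := exists_ne (0 : C₀(X, ℂ))
    have hmem : φ f ∈ NonUnitalStarAlgHom.range φ := ⟨f, rfl⟩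
    rw [hbot, NonUnitalStarAlgebra.mem_bot] at hmem
    exact hf (hφ (hmem.trans (map_zero φ).symm))
  obtain ⟨⟨_, f, rfl⟩, hp⟩ := h _ hclosed hne
  have hff : IsIdempotentElem f := hφ ((map_mul φ f f).trans (congrArg Subtype.val hp.mul_self))
  exact hp.ne_zero (Subtype.ext (by simp [zeroAtInfty_eq_zero_of_isIdempotentElem hff]))

/-- Extension by zero of functions in `C₀(s)` to the ambient space, as a homomorphism into the
algebra of all functions. -/
noncomputable def zeroExtension {X : Type*} [TopologicalSpace X] (s : Set X) :
    C₀(s, ℂ) →⋆ₙₐ[ℂ] (X → ℂ) where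
  toFun f := Function.extend Subtype.val f 0
  map_smul' c f := by
    simpa using Function.extend_smul c (Subtype.val : s → X) f (0 : X → ℂ)
  map_zero' := Function.extend_zero _
  map_add' f g := by
    simpa using Function.extend_add (Subtype.val : s → X) f g (0 : X → ℂ) 0
  map_mul' f g := by
    simpa using Function.extend_mul (Subtype.val : s → X) f g (0 : X → ℂ) 0
  map_star' f := by
    have h0 : star ∘ (0 : X → ℂ) = 0 := funext fun _ => star_zero ℂ
    funext x
    rw [Pi.star_apply, Function.apply_extend star, h0]
    rfl

section

variable {X : Type*} [TopologicalSpace X] {s : Set X} (f : C₀(s, ℂ))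

theorem zeroExtension_coe (x : s) : zeroExtension s f x = f x :=
  Subtype.val_injective.extend_apply f 0 x

theorem zeroExtension_of_notMem {x : X} (hx : x ∉ s) : zeroExtension s f x = 0 :=
  Function.extend_apply' (f : s → ℂ) (0 : X → ℂ) x fun ⟨y, hy⟩ => hx (hy ▸ y.2)

theorem continuousOn_zeroExtension [T2Space X] {K : Set X} (hs : ∀ x ∈ s, s ∈ 𝓝[K] x) :
    ContinuousOn (zeroExtension s f) K := by
  intro x _
  by_cases hxs : x ∈ s
  · have hcont : ContinuousOn (zeroExtension s f) s := by
      rw [continuousOn_iff_continuous_domRestrict]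
      exact (map_continuous f).congr fun y => (zeroExtension_coe f y).symm
    exact (hcont x hxs).mono_of_mem_nhdsWithin (hs x hxs)
  · refine ContinuousAt.continuousWithinAt ?_
    rw [ContinuousAt, zeroExtension_of_notMem f hxs]
    intro V hV
    obtain ⟨C, hC, hCV⟩ := mem_cocompact.1 (zero_at_infty f hV)
    have hCc : IsClosed (Subtype.val '' C) := (hC.image continuous_subtype_val).isClosed
    have hxC : x ∉ Subtype.val '' C := fun ⟨y, _, hy⟩ => hxs (hy ▸ y.2)
    rw [mem_map]
    filter_upwards [hCc.isOpen_compl.mem_nhds hxC] with z hz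
    by_cases hzs : z ∈ s
    · rw [Set.mem_preimage, zeroExtension_coe f ⟨z, hzs⟩]
      exact hCV fun hmem => hz ⟨_, hmem, rfl⟩
    · rw [Set.mem_preimage, zeroExtension_of_notMem f hzs]
      exact mem_of_mem_nhds hV

end

variable {A : Type u} [NonUnitalCStarAlgebra A]

theorem exists_injective_of_quasispectrum_eq_Icc {b : A} (hb : IsSelfAdjoint b)
    (hspec : quasispectrum ℝ b = Set.Icc 0 1) :
    ∃ φ : C₀(Set.Ioc (0 : ℝ) 1, ℂ) →⋆ₙₐ[ℂ] A, Function.Injective φ := by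
  have hspecℂ : quasispectrum ℂ b = (fun t : ℝ => (t : ℂ)) '' Set.Icc 0 1 := by
    rw [← hspec]
    exact hb.quasispectrumRestricts.algebraMap_image.symm
  let F (f : C₀(Set.Ioc (0 : ℝ) 1, ℂ)) (z : ℂ) : ℂ := zeroExtension _ f z.re
  have hF (f) : ContinuousOn (F f) (quasispectrum ℂ b) := by
    refine (continuousOn_zeroExtension (K := Set.Icc 0 1) f fun x hx => ?_).comp
      Complex.continuous_re.continuousOn ?_
    · filter_upwards [self_mem_nhdsWithin, mem_nhdsWithin_of_mem_nhds (Ioi_mem_nhds hx.1)]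
        with y hy hy0 using ⟨hy0, hy.2⟩
    · rw [hspecℂ]
      rintro _ ⟨t, ht, rfl⟩
      exact ht
  have hF0 (f) : F f 0 = 0 := zeroExtension_of_notMem f fun h => lt_irrefl _ h.1
  have hnormal : IsStarNormal b := hb.isStarNormal
  let φ : C₀(Set.Ioc (0 : ℝ) 1, ℂ) →⋆ₙₐ[ℂ] A :=
    { toFun := fun f => cfcₙ (F f) b
      map_smul' := fun c f => by
        simpa [F] using cfcₙ_const_mul c (F f) b (hF f) (hF0 f)
      map_zero' := by simp [F]
      map_add' := fun f g => by
        simpa [F] using cfcₙ_add (F f) (F g) b (hF f) (hF0 f) (hF g) (hF0 g)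
      map_mul' := fun f g => by
        simpa [F] using cfcₙ_mul (F f) (F g) b (hF f) (hF0 f) (hF g) (hF0 g)
      map_star' := fun f => by
        simpa [F, map_star] using cfcₙ_star (F f) b }
  refine ⟨φ, fun f g hfg => ZeroAtInftyContinuousMap.ext fun x => ?_⟩
  have hx : ((x : ℝ) : ℂ) ∈ quasispectrum ℂ b := hspecℂ ▸ ⟨x, ⟨x.2.1.le, x.2.2⟩, rfl⟩
  have hfgx : F f x = F g x :=
    eqOn_of_cfcₙ_eq_cfcₙ hfg hnormal (hF f) (hF0 f) (hF g) (hF0 g) hx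
  simpa only [F, Complex.ofReal_re, zeroExtension_coe] using hfgx

theorem countable_quasispectrum_of_not_exists_injective
    (h : ¬ ∃ φ : C₀(Set.Ioc (0 : ℝ) 1, ℂ) →⋆ₙₐ[ℂ] A, Function.Injective φ) {a : A}
    (ha : IsSelfAdjoint a) : (quasispectrum ℝ a).Countable := by
  by_contra hunc
  have hunc0 : ¬ (quasispectrum ℝ a \ {0}).Countable := fun hc =>
    hunc ((hc.union (Set.countable_singleton 0)).mono (by simp))
  obtain ⟨f, hf, hf0, hfK⟩ := exists_continuous_image_eq_Icc_of_not_countable_sdiff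
    (isClosed_quasispectrum_real a) isClosed_singleton hunc0
  refine h (exists_injective_of_quasispectrum_eq_Icc (b := cfcₙ f a) (cfcₙ_predicate f a) ?_)
  rw [cfcₙ_map_quasispectrum f a hf.continuousOn (hf0 0 rfl) ha, hfK]

end ZeroAtInfty

theorem theorem1p3 (A : Type u) [NonUnitalCStarAlgebra A] :
    List.TFAE [
      -- every nonzero `*`-homomorphic image has a minimal projection
      ∀ (B : Type u) [NonUnitalCStarAlgebra B] (π : A →⋆ₙₐ[ℂ] B),
        Function.Surjective π → Nontrivial B → ∃ p : B, IsMinimalProjection p,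
      -- there is a Cantor-Bendixson sequence
      ∃ (ht : Ordinal.{u}) (I : Ordinal.{u} → ClosedIdeal A), IsIdealSeries ht I ∧
        ∀ α < ht, (atomicIdeal (I α).Quotient : Set (I α).Quotient) =
          {x | ∃ a ∈ I (α + 1), ClosedIdeal.Quotient.mk (I α) a = x},
      -- there is a composition series with elementary quotients
      ∃ (m : Ordinal.{u}) (J : Ordinal.{u} → ClosedIdeal A), IsIdealSeries m J ∧
        ∀ α < m, IsElementary ((J (α + 1)).subquotient (J α)),
      -- every nonzero `C^*`-subalgebra has a minimal projection
      ∀ S : NonUnitalStarSubalgebra ℂ A, IsClosed (S : Set A) → S ≠ ⊥ →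
        ∃ p : S, IsMinimalProjection p,
      -- there is no copy of `C_0((0,1])` in `A`
      ¬ ∃ φ : C₀(Set.Ioc (0 : ℝ) 1, ℂ) →⋆ₙₐ[ℂ] A, Function.Injective φ,
      -- self-adjoint elements have countable spectrum
      ∀ a : A, IsSelfAdjoint a → (quasispectrum ℂ a).Countable] := by
  have hreal : (∀ a : A, IsSelfAdjoint a → (quasispectrum ℂ a).Countable) ↔
      ∀ a : A, IsSelfAdjoint a → (quasispectrum ℝ a).Countable :=
    forall₂_congr fun _ ha => (countable_quasispectrum_real_iff ha).symm
  rw [hreal]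
  tfae_have 1 → 2 := exists_cantorBendixson_of_quotient
  tfae_have 2 → 1
  | ⟨_, _, hI, hat⟩, _, _, _, hπ, _ => exists_isMinimalProjection_of_cantorBendixson hI hat hπ
  tfae_have 1 → 3 := exists_elementarySeries_of_quotient
  tfae_have 3 → 6
  | ⟨_, _, hJ, hel⟩, _, ha => countable_quasispectrum_of_elementarySeries hJ hel ha
  tfae_have 6 → 4 := fun h _ hS hS0 => exists_isMinimalProjection_subalgebra h hS hS0
  tfae_have 6 → 1 := fun h _ _ _ hπ _ => exists_isMinimalProjection_of_surjective h hπ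
  tfae_have 4 → 5 := fun h => by
    have _ : NoncompactSpace (Set.Ioc (0 : ℝ) 1) := noncompactSpace_Ioc one_pos
    have _ : ConnectedSpace (Set.Ioc (0 : ℝ) 1) :=
      isConnected_iff_connectedSpace.1 (isConnected_Ioc one_pos)
    have _ : LocallyCompactSpace (Set.Ioc (0 : ℝ) 1) := isLocallyClosed_Ioc.locallyCompactSpace
    exact not_exists_injective_of_forall_subalgebra h
  tfae_have 5 → 6 := fun h _ ha => countable_quasispectrum_of_not_exists_injective h ha
  tfae_finish
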